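/- Consider $n$ agents and $m$ chores. Each disutility $d_i(j)$ of agent $i$ for chore $j$ is drawn independently from a probability distribution $\mathcal{D}$ on $[0,1]$, and disutilities are additive: $d_i(S)=\sum_{j\in S} d_i(j)$ for every set $S$ of chores. Assume that $\mathcal{D}$ is PDF-bounded, i.e. there are constants $\alpha,\beta>0$ such that $\mathcal{D}$ has a density $f$ on $[0,1]$ with $\alpha\le f(x)\le\beta$ for all $x\in[0,1]$. An allocation is a partition of the set of chores into $n$ (possibly empty) bundles $A_1,\dots,A_n$; it is envy-free if $d_i(A_i)\le d_i(A_{i'})$ for all agents $i,i'$. (1) If $m=m(n)\ge 2n$, then the probability that an envy-free allocation exists tends to $1$ as $n\to\infty$. (2) Moreover, there is a polynomial-time algorithm that computes such an allocation with high probability: for every PDF-bounded $\mathcal{D}$ there is a single deterministic program that, on every input $(n,m,(d_i(j))_{i\le n,\,j\le m})$ with real $d_i(j)$, halts after a number of steps bounded by a polynomial in $n$ and $m$, and such that, whenever $m=m(n)\ge 2n$, the probability that its output is an envy-free allocation tends to $1$ as $n\to\infty$. Here programs are programs of a random access machine whose memory holds natural and real numbers, and a step is a memory access, an addition, a subtraction,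 a comparison, or the use of a natural number as a constant or as a real number. -/

import Mathlib

open MeasureTheory Filter Topology

namespace ChoreDivision

/-! ### The probabilistic model -/

/-- `D` has a probability density function, carried by `[0, 1]`, whose values on `[0, 1]` lie
between `α` and `β`. -/
def IsPDFBoundedBy (α β : ℝ) (D : Measure ℝ) : Prop :=
  ∃ f : ℝ → ℝ, Measurable f ∧ (∀ x ∈ Set.Icc (0 : ℝ) 1, α ≤ f x ∧ f x ≤ β) ∧
    D = (volume.restrict (Set.Icc (0 : ℝ) 1)).withDensity (fun x => ENNReal.ofReal (f x))

/-- `D` is PDF-bounded: its density on `[0, 1]` lies between two positive constants. -/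
def IsPDFBounded (D : Measure ℝ) : Prop :=
  ∃ α β : ℝ, 0 < α ∧ 0 < β ∧ IsPDFBoundedBy α β D

/-- The law of the disutilities `d i j` (agent `i`, chore `j`): independent draws from `D`. -/
noncomputable def disutilityLaw (D : Measure ℝ) (n m : ℕ) : Measure (Fin n → Fin m → ℝ) :=
  Measure.pi fun _ => Measure.pi fun _ => D

/-- With `m n` chores for `n` agents, the event `E` occurs with high probability. It is phrased as
"the probability that `E` fails tends to `0`", so that nothing is lost should `E` not be known to be
measurable (the measure of a set that is not measurable is its outer measure). -/
def WithHighProbability (D : Measure ℝ) (m : ℕ → ℕ)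
    (E : ∀ n m : ℕ, (Fin n → Fin m → ℝ) → Prop) : Prop :=
  Tendsto (fun n => disutilityLaw D n (m n) {d | ¬ E n (m n) d}) atTop (𝓝 0)

/-! ### Allocations and envy-freeness -/

/-- The bundles `A i` are pairwise disjoint and cover the set of chores. -/
def IsAllocation {n m : ℕ} (A : Fin n → Finset (Fin m)) : Prop :=
  (∀ i i' : Fin n, i ≠ i' → Disjoint (A i) (A i')) ∧ ∀ j : Fin m, ∃ i : Fin n, j ∈ A i

/-- The additive disutility of agent `i` for a set of chores. -/
noncomputable def bundleCost {n m : ℕ} (d : Fin n → Fin m → ℝ) (i : Fin n) (S : Finset (Fin m)) :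
    ℝ :=
  ∑ j ∈ S, d i j

/-- No agent prefers another agent's bundle. -/
def IsEnvyFree {n m : ℕ} (d : Fin n → Fin m → ℝ) (A : Fin n → Finset (Fin m)) : Prop :=
  ∀ i i' : Fin n, bundleCost d i (A i) ≤ bundleCost d i (A i')

/-! ### The machine model

A random access machine with real arithmetic, programmed in a language of `while` programs. Its
memory consists of arrays of natural numbers and arrays of real numbers. On numbers of either kind it
can only add, subtract and compare; there is no multiplication and no rounding of reals, and each
operation costs one step. -/

/-- Memory contents: `nat x i j` is entry `(i, j)` of the array of natural numbers named `x`, and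
likewise `real x i j` for the arrays of reals. -/
structure Memory where
  nat : ℕ → ℕ → ℕ → ℕ
  real : ℕ → ℕ → ℕ → ℝ

/-- Expressions of natural number type; array indices are computed at run time. -/
inductive NatExp where
  | const (k : ℕ)
  | get (x : ℕ) (i j : NatExp)
  | add (a b : NatExp)
  | sub (a b : NatExp)

/-- Expressions of real type; the only real constants are the natural numbers. -/
inductive RealExp where
  | ofNat (a : NatExp)
  | get (x : ℕ) (i j : NatExp)
  | add (a b : RealExp)
  | sub (a b : RealExp)

/-- Tests. -/
inductive Test where
  | natLe (a b : NatExp)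
  | realLe (a b : RealExp)
  | not (b : Test)
  | and (b c : Test)

/-- Programs. -/
inductive Program where
  | skip
  | setNat (x : ℕ) (i j : NatExp) (v : NatExp)
  | setReal (x : ℕ) (i j : NatExp) (v : RealExp)
  | seq (P Q : Program)
  | ite (b : Test) (P Q : Program)
  | while (b : Test) (P : Program)

/-- Value (subtraction is truncated at `0`). -/
def NatExp.eval (s : Memory) : NatExp → ℕ
  | .const k => k
  | .get x i j => s.nat x (i.eval s) (j.eval s)
  | .add a b => a.eval s + b.eval s
  | .sub a b => a.eval s - b.eval s

/-- Number of operations performed by an evaluation. -/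
def NatExp.cost : NatExp → ℕ
  | .const _ => 1
  | .get _ i j => i.cost + j.cost + 1
  | .add a b => a.cost + b.cost + 1
  | .sub a b => a.cost + b.cost + 1

/-- Value. -/
noncomputable def RealExp.eval (s : Memory) : RealExp → ℝ
  | .ofNat a => (a.eval s : ℝ)
  | .get x i j => s.real x (i.eval s) (j.eval s)
  | .add a b => a.eval s + b.eval s
  | .sub a b => a.eval s - b.eval s

/-- Number of operations performed by an evaluation. -/
def RealExp.cost : RealExp → ℕ
  | .ofNat a => a.cost + 1
  | .get _ i j => i.cost + j.cost + 1
  | .add a b => a.cost + b.cost + 1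
  | .sub a b => a.cost + b.cost + 1

/-- The test succeeds. -/
def Test.Holds (s : Memory) : Test → Prop
  | .natLe a b => a.eval s ≤ b.eval s
  | .realLe a b => a.eval s ≤ b.eval s
  | .not b => ¬ b.Holds s
  | .and b c => b.Holds s ∧ c.Holds s

/-- Number of operations performed by a test. -/
def Test.cost : Test → ℕ
  | .natLe a b => a.cost + b.cost + 1
  | .realLe a b => a.cost + b.cost + 1
  | .not b => b.cost + 1
  | .and b c => b.cost + c.cost + 1

/-- Overwrite entry `(i, j)` of the array of natural numbers named `x`. -/
def Memory.setNat (s : Memory) (x i j v : ℕ) : Memory where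
  nat := fun x' i' j' => if x' = x ∧ i' = i ∧ j' = j then v else s.nat x' i' j'
  real := s.real

/-- Overwrite entry `(i, j)` of the array of reals named `x`. -/
noncomputable def Memory.setReal (s : Memory) (x i j : ℕ) (v : ℝ) : Memory where
  nat := s.nat
  real := fun x' i' j' => if x' = x ∧ i' = i ∧ j' = j then v else s.real x' i' j'

/-- `Exec P s s' t`: started in memory `s`, the program `P` halts in memory `s'` after exactly `t`
steps. -/
inductive Exec : Program → Memory → Memory → ℕ → Prop where
  | skip (s : Memory) : Exec .skip s s 1
  | setNat (s : Memory) (x : ℕ) (i j v : NatExp) :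
      Exec (.setNat x i j v) s (s.setNat x (i.eval s) (j.eval s) (v.eval s))
        (i.cost + j.cost + v.cost + 1)
  | setReal (s : Memory) (x : ℕ) (i j : NatExp) (v : RealExp) :
      Exec (.setReal x i j v) s (s.setReal x (i.eval s) (j.eval s) (v.eval s))
        (i.cost + j.cost + v.cost + 1)
  | seq {P Q : Program} {s s' s'' : Memory} {t t' : ℕ} :
      Exec P s s' t → Exec Q s' s'' t' → Exec (.seq P Q) s s'' (t + t')
  | iteTrue {b : Test} {P Q : Program} {s s' : Memory} {t : ℕ} :
      b.Holds s → Exec P s s' t → Exec (.ite b P Q) s s' (b.cost + 1 + t)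
  | iteFalse {b : Test} {P Q : Program} {s s' : Memory} {t : ℕ} :
      ¬ b.Holds s → Exec Q s s' t → Exec (.ite b P Q) s s' (b.cost + 1 + t)
  | whileFalse {b : Test} {P : Program} {s : Memory} :
      ¬ b.Holds s → Exec (.while b P) s s (b.cost + 1)
  | whileTrue {b : Test} {P : Program} {s s' s'' : Memory} {t t' : ℕ} :
      b.Holds s → Exec P s s' t → Exec (.while b P) s' s'' t' →
        Exec (.while b P) s s'' (b.cost + 1 + t + t')

/-- Programs are deterministic: the final memory and the number of steps are unique. -/
theorem Exec.deterministic {P : Program} {s s₁ s₂ : Memory} {t₁ t₂ : ℕ}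
    (h₁ : Exec P s s₁ t₁) (h₂ : Exec P s s₂ t₂) : s₁ = s₂ ∧ t₁ = t₂ := by
  induction h₁ generalizing s₂ t₂ with
  | skip s => cases h₂; exact ⟨rfl, rfl⟩
  | setNat s x i j v => cases h₂; exact ⟨rfl, rfl⟩
  | setReal s x i j v => cases h₂; exact ⟨rfl, rfl⟩
  | seq _ _ ih ih' =>
    cases h₂ with
    | seq g g' =>
      obtain ⟨rfl, rfl⟩ := ih g
      obtain ⟨rfl, rfl⟩ := ih' g'
      exact ⟨rfl, rfl⟩
  | iteTrue hb _ ih =>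
    cases h₂ with
    | iteTrue _ g => obtain ⟨rfl, rfl⟩ := ih g; exact ⟨rfl, rfl⟩
    | iteFalse hb' _ => exact absurd hb hb'
  | iteFalse hb _ ih =>
    cases h₂ with
    | iteTrue hb' _ => exact absurd hb' hb
    | iteFalse _ g => obtain ⟨rfl, rfl⟩ := ih g; exact ⟨rfl, rfl⟩
  | whileFalse hb =>
    cases h₂ with
    | whileFalse _ => exact ⟨rfl, rfl⟩
    | whileTrue hb' _ _ => exact absurd hb' hb
  | whileTrue hb _ _ ih ih' =>
    cases h₂ with
    | whileFalse hb' => exact absurd hb hb'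
    | whileTrue _ g g' =>
      obtain ⟨rfl, rfl⟩ := ih g
      obtain ⟨rfl, rfl⟩ := ih' g'
      exact ⟨rfl, rfl⟩

/-- Initial memory on the instance `d`: the number of agents is in `nat 0 0 0`, the number of chores
in `nat 1 0 0`, the disutility of chore `j` for agent `i` in `real 0 i j`; all other entries are
`0`. -/
noncomputable def inputMemory {n m : ℕ} (d : Fin n → Fin m → ℝ) : Memory where
  nat := fun x i j =>
    if x = 0 ∧ i = 0 ∧ j = 0 then n else if x = 1 ∧ i = 0 ∧ j = 0 then m else 0
  real := fun x i j =>
    if h : x = 0 ∧ i < n ∧ j < m then d ⟨i, h.2.1⟩ ⟨j, h.2.2⟩ else 0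

/-- The bundles read off a final memory: chore `j` goes to the agent whose number is in
`nat 2 j 0` (to nobody if that number is not the number of an agent). -/
def outputBundles (n m : ℕ) (s : Memory) (i : Fin n) : Finset (Fin m) :=
  Finset.univ.filter fun j => s.nat 2 j 0 = i

/-- On every instance, the program halts after a number of steps that is polynomial in the number of
agents and the number of chores. -/
def RunsInPolyTime (P : Program) : Prop :=
  ∃ p : Polynomial ℕ, ∀ (n m : ℕ) (d : Fin n → Fin m → ℝ),
    ∃ (s : Memory) (t : ℕ), Exec P (inputMemory d) s t ∧ t ≤ p.eval (n + m)

/-- On the instance `d`, the program halts and outputs an envy-free allocation. -/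
def FindsEnvyFree (P : Program) (n m : ℕ) (d : Fin n → Fin m → ℝ) : Prop :=
  ∃ (s : Memory) (t : ℕ), Exec P (inputMemory d) s t ∧
    IsAllocation (outputBundles n m s) ∧ IsEnvyFree d (outputBundles n m s)

end ChoreDivision

/-! # Envy-free allocations of random chores

Let `L = Nat.log 2 n + 1`. The program computes two thresholds and chooses between two allocations.

If there are at least `C' * n * L` chores, each chore goes to an agent who minds it least. For a pair of
agents `i`, `i'`, each chore changes the envy of `i` towards `i'` by an amount that is at most
`envyBound i i'` of its column of disutilities. This bound has negative mean of order `1 / n`: agent `i`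
gets the chore with probability `O(1 / n)` and then minds it by `O(1 / n)` only, whereas with
probability of order `1 / n` it goes to `i'` while `i` minds it by more than `1 / 2`. The second moment
is `O(1 / n)`, so that the exponential moment of the bound is at most `exp (-κ / n)` for a suitable
exponent (`exists_integral_exp_envyBound_le`). The columns are independent, and a Chernoff bound leaves
probability at most `exp (-κ * m / n) ≤ n⁻³` for each of the `n²` pairs.

If there are fewer chores, every agent gets `m / n` or `m / n + 1` of them, each of disutility at most
`τ = C * L / n`. Envy can then only arise from a pair of chores in one bundle that are both of
disutility at most `3 * τ` for somebody else as well, that is, from a rectangle of two agents and two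
chores with four small disutilities. Pairs in such rectangles are not used (`Acceptable`), and this
makes the allocation envy-free (`isEnvyFree_of_acceptable`). It remains to find a matching of the chores
to the `m` slots of the agents, which exists if Hall's condition holds. With high probability no set of
at most four agents and four chores spans more small pairs than it has elements, so that distinct
rectangles are disjoint (`rectangle_unique`) and each agent and each chore loses at most two pairs. A
violation of Hall's condition then means that a set of chores and a set of agents have almost no small
pairs in common, and a union bound over all such sets shows that this is unlikely
(`disutilityLaw_not_agentHall_le`).

The matching is found by an auction. A chore without a slot takes an admissible slot with the smallest
label, raises this label by `1`, and evicts the previous holder, who bids next. The labels stay bounded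
by `m` under Hall's condition (`AuctionState.exists_slot`), whence the auction ends after at most `m²`
bids. It needs neither augmenting paths nor any proof that a perfect matching exists.

The program is written in a language `Cmd` whose only loops are `for` loops bounded in terms of the
input sizes. Every such command terminates in polynomial time (`runsInPolyTime_toProgram`), and its
effect is a function `Cmd.run` on memories, about which one reasons by induction over the rounds of the
loops (`Cmd.loop_induction`). Existence of envy-free allocations follows from the success of the
program.
-/

namespace ChoreDivision

/-! ### Structured programs -/

@[simp] theorem Memory.setNat_nat (s : Memory) (x i j v x' i' j' : ℕ) :
    (s.setNat x i j v).nat x' i' j' = if x' = x ∧ i' = i ∧ j' = j then v else s.nat x' i' j' := rfl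

@[simp] theorem Memory.setNat_real (s : Memory) (x i j v : ℕ) :
    (s.setNat x i j v).real = s.real := rfl

@[simp] theorem Memory.setReal_nat (s : Memory) (x i j : ℕ) (v : ℝ) :
    (s.setReal x i j v).nat = s.nat := rfl

@[simp] theorem Memory.setReal_real (s : Memory) (x i j : ℕ) (v : ℝ) (x' i' j' : ℕ) :
    (s.setReal x i j v).real x' i' j' =
      if x' = x ∧ i' = i ∧ j' = j then v else s.real x' i' j' := rfl

theorem Memory.setNat_nat_of_ne (s : Memory) {x z : ℕ} (i j v : ℕ) (h : z ≠ x) :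
    (s.setNat x i j v).nat z = s.nat z := by
  ext i' j'; simp [h]

theorem Memory.setReal_real_of_ne (s : Memory) {x z : ℕ} (i j : ℕ) (v : ℝ) (h : z ≠ x) :
    (s.setReal x i j v).real z = s.real z := by
  ext i' j'; simp [h]

/-- Programs whose only loops are `for` loops: `loop x y k c` runs `c` with the counter `nat x 0 0`
going through `0, 1, …, nat y 0 0 + k - 1`. -/
inductive Cmd where
  | skip
  | setNat (x : ℕ) (i j v : NatExp)
  | setReal (x : ℕ) (i j : NatExp) (v : RealExp)
  | seq (c c' : Cmd)
  | ite (b : Test) (c c' : Cmd)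
  | loop (x y k : ℕ) (c : Cmd)

/-- The natural number variable `x`, stored in entry `(0, 0)` of the array `x`. -/
def NatExp.var (x : ℕ) : NatExp := .get x (.const 0) (.const 0)

@[simp] theorem NatExp.var_eval (x : ℕ) (s : Memory) : (NatExp.var x).eval s = s.nat x 0 0 := rfl

namespace Cmd

/-- Translation into `while` programs. -/
def toProgram : Cmd → Program
  | skip => .skip
  | setNat x i j v => .setNat x i j v
  | setReal x i j v => .setReal x i j v
  | seq c c' => .seq c.toProgram c'.toProgram
  | ite b c c' => .ite b c.toProgram c'.toProgram
  | loop x y k c => .seq (.setNat x (.const 0) (.const 0) (.const 0))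
      (.while (.not (.natLe (.add (.var y) (.const k)) (.var x)))
        (.seq c.toProgram (.setNat x (.const 0) (.const 0) (.add (.var x) (.const 1)))))

/-- The memory after `k` rounds of a loop with counter `x` whose body acts as `f`. -/
noncomputable def iterate (x : ℕ) (f : Memory → Memory) (s : Memory) : ℕ → Memory
  | 0 => s.setNat x 0 0 0
  | k + 1 => (f (iterate x f s k)).setNat x 0 0 (k + 1)

open Classical in
/-- The memory in which a command halts. -/
noncomputable def run : Cmd → Memory → Memory
  | skip, s => s
  | setNat x i j v, s => s.setNat x (i.eval s) (j.eval s) (v.eval s)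
  | setReal x i j v, s => s.setReal x (i.eval s) (j.eval s) (v.eval s)
  | seq c c', s => c'.run (c.run s)
  | ite b c c', s => if b.Holds s then c.run s else c'.run s
  | loop x y k c, s => iterate x c.run s (s.nat y 0 0 + k)

/-- The command does not write to the array of natural numbers `z`. -/
def KeepsNat (z : ℕ) : Cmd → Prop
  | skip => True
  | setNat x _ _ _ => z ≠ x
  | setReal _ _ _ _ => True
  | seq c c' => c.KeepsNat z ∧ c'.KeepsNat z
  | ite _ c c' => c.KeepsNat z ∧ c'.KeepsNat z
  | loop x _ _ c => z ≠ x ∧ c.KeepsNat z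

/-- The command does not write to the array of reals `z`. -/
def KeepsReal (z : ℕ) : Cmd → Prop
  | skip => True
  | setNat _ _ _ _ => True
  | setReal x _ _ _ => z ≠ x
  | seq c c' => c.KeepsReal z ∧ c'.KeepsReal z
  | ite _ c c' => c.KeepsReal z ∧ c'.KeepsReal z
  | loop _ _ _ c => c.KeepsReal z

/-- The input sizes in arrays `0` and `1` are never overwritten, only they serve as loop bounds, and
no loop body tampers with its own counter. -/
def WellFormed : Cmd → Prop
  | skip => True
  | setNat x _ _ _ => 2 ≤ x
  | setReal _ _ _ _ => True
  | seq c c' => c.WellFormed ∧ c'.WellFormed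
  | ite _ c c' => c.WellFormed ∧ c'.WellFormed
  | loop x y _ c => 2 ≤ x ∧ y < 2 ∧ c.KeepsNat x ∧ c.WellFormed

/-- A bound on the number of steps, as a polynomial in the sum of the two input sizes. -/
noncomputable def time : Cmd → Polynomial ℕ
  | skip => 1
  | setNat _ i j v => Polynomial.C (i.cost + j.cost + v.cost + 1)
  | setReal _ i j v => Polynomial.C (i.cost + j.cost + v.cost + 1)
  | seq c c' => c.time + c'.time
  | ite b c c' => Polynomial.C (b.cost + 1) + c.time + c'.time
  | loop _ _ k c => Polynomial.C 15 + (Polynomial.X + Polynomial.C k) * (Polynomial.C 19 + c.time)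

theorem WellFormed.keepsNat {z : ℕ} (hz : z < 2) :
    ∀ {c : Cmd}, c.WellFormed → c.KeepsNat z
  | skip, _ => trivial
  | setNat _ _ _ _, h => by simp only [WellFormed] at h; simp only [KeepsNat]; omega
  | setReal _ _ _ _, _ => trivial
  | seq _ _, h => ⟨h.1.keepsNat hz, h.2.keepsNat hz⟩
  | ite _ _ _, h => ⟨h.1.keepsNat hz, h.2.keepsNat hz⟩
  | loop _ _ _ _, h => ⟨by have := h.1; omega, h.2.2.2.keepsNat hz⟩

theorem run_nat {z : ℕ} : ∀ {c : Cmd}, c.KeepsNat z → ∀ s : Memory, (c.run s).nat z = s.nat z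
  | skip, _, _ => rfl
  | setNat _ _ _ _, h, s => s.setNat_nat_of_ne _ _ _ h
  | setReal _ _ _ _, _, _ => rfl
  | seq _ _, h, s => by rw [run, run_nat h.2, run_nat h.1]
  | ite b _ _, h, s => by
      rw [run]; split_ifs
      · exact run_nat h.1 s
      · exact run_nat h.2 s
  | loop x y k c, h, s => by
      rw [run]
      induction s.nat y 0 0 + k with
      | zero => exact s.setNat_nat_of_ne _ _ _ h.1
      | succ k ih => rw [iterate, Memory.setNat_nat_of_ne _ _ _ _ h.1, run_nat h.2, ih]

theorem run_real {z : ℕ} : ∀ {c : Cmd}, c.KeepsReal z → ∀ s : Memory, (c.run s).real z = s.real z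
  | skip, _, _ => rfl
  | setNat _ _ _ _, _, _ => rfl
  | setReal _ _ _ _, h, s => s.setReal_real_of_ne _ _ _ h
  | seq _ _, h, s => by rw [run, run_real h.2, run_real h.1]
  | ite b _ _, h, s => by
      rw [run]; split_ifs
      · exact run_real h.1 s
      · exact run_real h.2 s
  | loop x y k c, h, s => by
      rw [run]
      induction s.nat y 0 0 + k with
      | zero => rfl
      | succ k ih => rw [iterate, Memory.setNat_real, run_real (c := c) h, ih]

/-- Induction over the rounds of a loop. Before each round, every array that the loop does not
write still has its initial contents. -/
theorem loop_induction {x y k N : ℕ} {c : Cmd} {s : Memory}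
    (hN : s.nat y 0 0 + k = N) (P : ℕ → Memory → Prop)
    (zero : P 0 (s.setNat x 0 0 0))
    (succ : ∀ r < N, ∀ s' : Memory, s'.nat x 0 0 = r →
      (∀ z, (loop x y k c).KeepsNat z → s'.nat z = s.nat z) →
      (∀ z, (loop x y k c).KeepsReal z → s'.real z = s.real z) →
      P r s' → P (r + 1) ((c.run s').setNat x 0 0 (r + 1))) :
    P N ((loop x y k c).run s) := by
  have key : ∀ r ≤ N, (iterate x c.run s r).nat x 0 0 = r ∧
      (∀ z, (loop x y k c).KeepsNat z → (iterate x c.run s r).nat z = s.nat z) ∧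
      (∀ z, (loop x y k c).KeepsReal z → (iterate x c.run s r).real z = s.real z) ∧
      P r (iterate x c.run s r) := by
    intro r
    induction r with
    | zero =>
      intro _
      refine ⟨by simp [iterate], fun z hz => ?_, fun z _ => rfl, zero⟩
      exact s.setNat_nat_of_ne _ _ _ hz.1
    | succ r ih =>
      intro hr
      obtain ⟨h1, h2, h3, h4⟩ := ih (by omega)
      refine ⟨by simp [iterate], fun z hz => ?_, fun z hz => ?_, ?_⟩
      · rw [iterate, Memory.setNat_nat_of_ne _ _ _ _ hz.1, run_nat hz.2, h2 z hz]
      · rw [iterate, Memory.setNat_real, run_real (c := c) hz, h3 z hz]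
      · exact succ r (by omega) _ h1 h2 h3 h4
  rw [run, hN]
  exact (key N le_rfl).2.2.2

/-- A well-formed command, translated into a `while` program, halts in the memory computed by `run`
within the polynomial number of steps computed by `time`. -/
theorem exec_toProgram : ∀ {c : Cmd}, c.WellFormed → ∀ s : Memory,
    ∃ t, Exec c.toProgram s (c.run s) t ∧ t ≤ c.time.eval (s.nat 0 0 0 + s.nat 1 0 0)
  | skip, _, s => ⟨1, .skip s, by simp [time]⟩
  | setNat x i j v, _, s => ⟨_, .setNat s x i j v, by simp [time]⟩
  | setReal x i j v, _, s => ⟨_, .setReal s x i j v, by simp [time]⟩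
  | seq c c', h, s => by
      obtain ⟨t, h1, h2⟩ := exec_toProgram h.1 s
      obtain ⟨t', h1', h2'⟩ := exec_toProgram h.2 (c.run s)
      rw [run_nat (h.1.keepsNat (by norm_num)), run_nat (h.1.keepsNat (by norm_num))] at h2'
      exact ⟨t + t', .seq h1 h1', by simp only [time, Polynomial.eval_add]; omega⟩
  | ite b c c', h, s => by
      by_cases hb : b.Holds s
      · obtain ⟨t, h1, h2⟩ := exec_toProgram h.1 s
        refine ⟨b.cost + 1 + t, ?_, ?_⟩
        · rw [run, if_pos hb]; exact .iteTrue hb h1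
        · simp only [time, Polynomial.eval_add, Polynomial.eval_C]; omega
      · obtain ⟨t, h1, h2⟩ := exec_toProgram h.2 s
        refine ⟨b.cost + 1 + t, ?_, ?_⟩
        · rw [run, if_neg hb]; exact .iteFalse hb h1
        · simp only [time, Polynomial.eval_add, Polynomial.eval_C]; omega
  | loop x y k c, h, s => by
      obtain ⟨hx, hy, hcx, hc⟩ := h
      set N := s.nat y 0 0 + k with hN
      set T := c.time.eval (s.nat 0 0 0 + s.nat 1 0 0) with hT
      have hyx : y ≠ x := by omega
      have keep : ∀ r, (iterate x c.run s r).nat x 0 0 = r ∧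
          ∀ z < 2, (iterate x c.run s r).nat z = s.nat z := by
        intro r
        induction r with
        | zero => exact ⟨by simp [iterate], fun z hz => s.setNat_nat_of_ne _ _ _ (by omega)⟩
        | succ r ih =>
          refine ⟨by simp [iterate], fun z hz => ?_⟩
          rw [iterate, Memory.setNat_nat_of_ne _ _ _ _ (by omega), run_nat (hc.keepsNat hz),
            ih.2 z hz]
      -- the last `r` rounds of the loop
      have key : ∀ r ≤ N, ∃ t, Exec (.while (.not (.natLe (.add (.var y) (.const k)) (.var x)))
          (.seq c.toProgram (.setNat x (.const 0) (.const 0) (.add (.var x) (.const 1)))))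
          (iterate x c.run s (N - r)) (iterate x c.run s N) t ∧ t ≤ 11 + r * (19 + T) := by
        intro r
        induction r with
        | zero =>
          intro _
          refine ⟨_, .whileFalse ?_, ?_⟩
          · rw [Nat.sub_zero]
            simp [Test.Holds, NatExp.eval, (keep N).1, (keep N).2 y hy, ← hN]
          · simp [Test.cost, NatExp.cost, NatExp.var]
        | succ r ih =>
          intro hr
          obtain ⟨t, h1, h2⟩ := ih (by omega)
          obtain ⟨t', h1', h2'⟩ := exec_toProgram hc (iterate x c.run s (N - (r + 1)))
          rw [(keep _).2 0 (by norm_num), (keep _).2 1 (by norm_num), ← hT] at h2'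
          have e : iterate x c.run s (N - r) =
              (c.run (iterate x c.run s (N - (r + 1)))).setNat x 0 0
                ((c.run (iterate x c.run s (N - (r + 1)))).nat x 0 0 + 1) := by
            have : N - r = (N - (r + 1)) + 1 := by omega
            rw [this, iterate, run_nat hcx, (keep _).1]
          refine ⟨_, .whileTrue ?_ (.seq h1' (.setNat _ _ _ _ _)) (e ▸ h1), ?_⟩
          · simp [Test.Holds, NatExp.eval, (keep (N - (r + 1))).1, (keep (N - (r + 1))).2 y hy]
            omega
          · simp only [Test.cost, NatExp.cost, NatExp.var]
            have : (r + 1) * (19 + T) = r * (19 + T) + (19 + T) := by ring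
            omega
      obtain ⟨t, h1, h2⟩ := key N le_rfl
      rw [Nat.sub_self] at h1
      refine ⟨_, .seq (.setNat _ _ _ _ _) h1, ?_⟩
      simp only [time, Polynomial.eval_add, Polynomial.eval_C, Polynomial.eval_mul,
        Polynomial.eval_X, NatExp.cost, ← hT]
      have hNle : N ≤ s.nat 0 0 0 + s.nat 1 0 0 + k := by
        interval_cases y <;> omega
      have := Nat.mul_le_mul_right (19 + T) hNle
      omega

end Cmd

/-- A well-formed command runs in polynomial time. -/
theorem runsInPolyTime_toProgram {c : Cmd} (h : c.WellFormed) : RunsInPolyTime c.toProgram := by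
  refine ⟨c.time, fun n m d => ?_⟩
  obtain ⟨t, h1, h2⟩ := c.exec_toProgram h (inputMemory d)
  exact ⟨_, t, h1, by simpa [inputMemory] using h2⟩

theorem findsEnvyFree_toProgram {c : Cmd} (h : c.WellFormed) {n m : ℕ} {d : Fin n → Fin m → ℝ}
    (hA : IsAllocation (outputBundles n m (c.run (inputMemory d))))
    (hE : IsEnvyFree d (outputBundles n m (c.run (inputMemory d)))) :
    FindsEnvyFree c.toProgram n m d := by
  obtain ⟨t, h1, -⟩ := c.exec_toProgram h (inputMemory d)
  exact ⟨_, t, h1, hA, hE⟩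

/-! ### The auction -/

/-- The state of the auction in which chores bid for slots, after the chores `0, …, u - 1` have
entered. `R j σ` says that chore `j` may be put into slot `σ`. Chores are numbered from `1` here:
`h σ` is the chore held by slot `σ`, or `0` for none, and `c` is the chore that is looking for a slot,
or `0` for none. The number `ℓ σ` counts the bids that slot `σ` received; a chore always holds a slot
whose label is at most one above the smallest label it could have had. -/
structure AuctionState (m : ℕ) (R : ℕ → ℕ → Prop) (u : ℕ) (h ℓ : ℕ → ℕ) (c : ℕ) : Prop where
  adj : ∀ σ < m, ∀ j, h σ = j + 1 → R j σ
  le : ∀ σ < m, h σ ≤ u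
  inj : ∀ σ < m, ∀ σ' < m, h σ = h σ' → h σ ≠ 0 → σ = σ'
  cur_le : c ≤ u
  cur_ne : c ≠ 0 → ∀ σ < m, h σ ≠ c
  all : ∀ j < u, j + 1 = c ∨ ∃ σ < m, h σ = j + 1
  held : ∀ σ < m, ℓ σ ≠ 0 → h σ ≠ 0
  slack : ∀ σ < m, ∀ j, h σ = j + 1 → ∀ σ' < m, R j σ' → ℓ σ ≤ ℓ σ' + 1
  label_le : ∀ σ < m, ℓ σ ≤ m

/-- Hall's condition: any set of chores has at least as many admissible slots as elements. -/
def HallCondition (m : ℕ) (R : ℕ → ℕ → Prop) : Prop :=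
  ∀ S : Finset ℕ, S ⊆ Finset.range m → ∀ N : Finset ℕ,
    (∀ σ < m, ∀ j ∈ S, R j σ → σ ∈ N) → S.card ≤ N.card

namespace AuctionState

variable {m u j b : ℕ} {R : ℕ → ℕ → Prop} {h ℓ : ℕ → ℕ}

/-- Under Hall's condition a bidder always finds a slot with a label below `m`. Otherwise let `T k` be
the set of slots with label at least `k`. The chores held in `T (k + 1)` and the bidder have all their
admissible slots in `T k`, so `T k` has more elements than `T (k + 1)`, for each `k ≤ m`. -/
theorem exists_slot (hs : AuctionState m R u h ℓ (j + 1)) (hu : u ≤ m) (hall : HallCondition m R) :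
    ∃ σ < m, R j σ ∧ ℓ σ < m := by
  by_contra! hcon
  let T : ℕ → Finset ℕ := fun k => (Finset.range m).filter fun σ => k ≤ ℓ σ
  have step : ∀ k ≤ m, (T (k + 1)).card + 1 ≤ (T k).card := by
    intro k hk
    let S : Finset ℕ := insert j ((T (k + 1)).image fun σ => h σ - 1)
    have hpos : ∀ σ ∈ T (k + 1), h σ ≠ 0 := fun σ hσ => by
      simp only [T, Finset.mem_filter, Finset.mem_range] at hσ
      exact hs.held σ hσ.1 (by omega)
    have hcard : S.card = (T (k + 1)).card + 1 := by
      rw [Finset.card_insert_of_notMem, Finset.card_image_of_injOn]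
      · intro σ hσ σ' hσ' e
        have h1 := hpos σ hσ
        have h2 := hpos σ' hσ'
        simp only [T, Finset.coe_filter, Finset.mem_range, Set.mem_ofPred_eq] at hσ hσ'
        simp only at e
        exact hs.inj σ hσ.1 σ' hσ'.1 (by omega) h1
      · simp only [Finset.mem_image, not_exists, not_and]
        intro σ hσ e
        have h1 := hpos σ hσ
        simp only [T, Finset.mem_filter, Finset.mem_range] at hσ
        exact hs.cur_ne (by omega) σ hσ.1 (by omega)
    rw [← hcard]
    apply hall S
    · intro x hx
      simp only [S, Finset.mem_insert, Finset.mem_image] at hx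
      have := hs.cur_le
      rcases hx with rfl | ⟨σ, hσ, rfl⟩
      · simp; omega
      · have h1 := hpos σ hσ
        simp only [T, Finset.mem_filter, Finset.mem_range] at hσ
        have := hs.le σ hσ.1
        simp; omega
    · intro σ hσ x hx hR
      simp only [S, Finset.mem_insert, Finset.mem_image] at hx
      simp only [T, Finset.mem_filter, Finset.mem_range]
      refine ⟨hσ, ?_⟩
      rcases hx with rfl | ⟨σ', hσ', rfl⟩
      · exact hk.trans (hcon σ hσ hR)
      · have h1 := hpos σ' hσ'
        simp only [T, Finset.mem_filter, Finset.mem_range] at hσ'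
        have := hs.slack σ' hσ'.1 (h σ' - 1) (by omega) σ hσ hR
        omega
  have total : ∀ k ≤ m + 1, (T k).card + k ≤ (T 0).card := by
    intro k
    induction k with
    | zero => simp
    | succ k ih => intro hk; have := step k (by omega); have := ih (by omega); omega
  have h1 := total (m + 1) le_rfl
  have h2 : (T 0).card ≤ m := (Finset.card_filter_le _ _).trans (by simp)
  omega

/-- The bidder takes an admissible slot with the smallest label, and the previous holder becomes the
bidder. -/
theorem bid (hs : AuctionState m R u h ℓ (j + 1)) (hb : b < m) (hR : R j b) (hlt : ℓ b < m)
    (hmin : ∀ σ < m, R j σ → ℓ b ≤ ℓ σ) :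
    AuctionState m R u (Function.update h b (j + 1)) (Function.update ℓ b (ℓ b + 1)) (h b) where
  adj σ hσ i hi := by
    by_cases e : σ = b
    · subst e; simp at hi; exact hi ▸ hR
    · rw [Function.update_of_ne e] at hi; exact hs.adj σ hσ i hi
  le σ hσ := by
    by_cases e : σ = b
    · subst e; simpa using hs.cur_le
    · rw [Function.update_of_ne e]; exact hs.le σ hσ
  inj σ hσ σ' hσ' heq hne := by
    have := hs.cur_ne (by omega)
    by_cases e : σ = b <;> by_cases e' : σ' = b
    · rw [e, e']
    · subst e; rw [Function.update_of_ne e'] at heq; simp at heq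
      exact absurd heq.symm (this σ' hσ')
    · subst e'; rw [Function.update_of_ne e] at heq; simp at heq
      exact absurd heq (this σ hσ)
    · rw [Function.update_of_ne e] at heq hne; rw [Function.update_of_ne e'] at heq
      exact hs.inj σ hσ σ' hσ' heq hne
  cur_le := hs.le b hb
  cur_ne hne σ hσ := by
    by_cases e : σ = b
    · subst e; simpa using (hs.cur_ne (by omega) σ hσ).symm
    · rw [Function.update_of_ne e]
      exact fun heq => e (hs.inj σ hσ b hb heq (heq ▸ hne))
  all i hi := by
    rcases hs.all i hi with heq | ⟨σ, hσ, heq⟩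
    · exact .inr ⟨b, hb, by simp [heq]⟩
    · by_cases e : σ = b
      · subst e; exact .inl heq.symm
      · exact .inr ⟨σ, hσ, by rw [Function.update_of_ne e, heq]⟩
  held σ hσ := by
    by_cases e : σ = b
    · subst e; simp
    · rw [Function.update_of_ne e, Function.update_of_ne e]; exact hs.held σ hσ
  slack σ hσ i hi σ' hσ' hR' := by
    have hmono : ℓ σ' ≤ Function.update ℓ b (ℓ b + 1) σ' := by
      by_cases e : σ' = b
      · subst e; simp
      · rw [Function.update_of_ne e]
    by_cases e : σ = b
    · subst e
      simp at hi
      have := hmin σ' hσ' (hi ▸ hR')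
      simp only [Function.update_self]; omega
    · rw [Function.update_of_ne e] at hi ⊢
      have := hs.slack σ hσ i hi σ' hσ' hR'
      omega
  label_le σ hσ := by
    by_cases e : σ = b
    · subst e; simpa using hlt
    · rw [Function.update_of_ne e]; exact hs.label_le σ hσ

/-- A new chore enters when nobody is bidding. -/
theorem enter (hs : AuctionState m R u h ℓ 0) : AuctionState m R (u + 1) h ℓ (u + 1) where
  adj := hs.adj
  le σ hσ := (hs.le σ hσ).trans u.le_succ
  inj := hs.inj
  cur_le := le_rfl
  cur_ne _ σ hσ e := by have := hs.le σ hσ; omega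
  all i hi := by
    by_cases e : i = u
    · exact .inl (by rw [e])
    · rcases hs.all i (by omega) with h0 | h0
      · omega
      · exact .inr h0
  held := hs.held
  slack := hs.slack
  label_le := hs.label_le

end AuctionState

/-! ### The program -/

/-- `if b then c`. -/
def Cmd.cond (b : Test) (c : Cmd) : Cmd := .ite b c .skip

/-- `k * e`. -/
def NatExp.smul : ℕ → NatExp → NatExp
  | 0, _ => .const 0
  | k + 1, e => .add (NatExp.smul k e) e

@[simp] theorem NatExp.smul_eval (k : ℕ) (e : NatExp) (s : Memory) :
    (NatExp.smul k e).eval s = k * e.eval s := by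
  induction k with
  | zero => simp [NatExp.smul, NatExp.eval]
  | succ k ih => simp [NatExp.smul, NatExp.eval, ih]; ring

/-- Assignment to a natural number variable. -/
def Cmd.assign (x : ℕ) (v : NatExp) : Cmd := .setNat x (.const 0) (.const 0) v

/-- With `L` the number of binary digits of `n`, compute `C * L` in variable `8` and `C' * n * L` in
variable `9`. -/
def thresholds (C C' : ℕ) : Cmd :=
  .seq (.assign 7 (.const 1)) (.loop 3 0 0 (.cond (.natLe (.var 7) (.var 0))
    (.seq (.assign 7 (.add (.var 7) (.var 7)))
      (.seq (.assign 8 (.add (.var 8) (.const C)))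
        (.assign 9 (.add (.var 9) (.smul C' (.var 0))))))))

/-- Give each chore to an agent who minds it least. -/
def giveToLeast : Cmd :=
  .loop 3 1 0 (.seq (.setNat 2 (.var 3) (.const 0) (.const 0))
    (.loop 4 0 0 (.cond
      (.realLe (.get 0 (.var 4) (.var 3)) (.get 0 (.get 2 (.var 3) (.const 0)) (.var 3)))
      (.setNat 2 (.var 3) (.const 0) (.var 4)))))

/-- Compute `n` times the disutilities. -/
def scale : Cmd :=
  .loop 3 0 0 (.loop 4 1 0 (.loop 5 0 0 (.setReal 1 (.var 3) (.var 4)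
    (.add (.get 1 (.var 3) (.var 4)) (.get 0 (.var 3) (.var 4))))))

/-- `a ≠ b`. -/
def Test.ne (a b : NatExp) : Test := .not (.and (.natLe a b) (.natLe b a))

/-- The scaled disutility at `(i, j)` is at most three times the threshold. -/
def Test.near (i j : NatExp) : Test :=
  .realLe (.get 1 i j) (.ofNat (.add (.var 8) (.add (.var 8) (.var 8))))

/-- Mark the pairs that lie in a rectangle of pairs of small disutility. -/
def markBlocked : Cmd :=
  .loop 3 0 0 (.loop 4 1 0 (.loop 5 0 0 (.loop 6 1 0 (.cond
    (.and (.and (.ne (.var 3) (.var 5)) (.ne (.var 4) (.var 6)))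
      (.and (.and (.near (.var 3) (.var 4)) (.near (.var 3) (.var 6)))
        (.and (.near (.var 5) (.var 4)) (.near (.var 5) (.var 6)))))
    (.setNat 10 (.var 3) (.var 4) (.const 1))))))

/-- Slot `σ` belongs to agent `σ % n`. -/
def assignOwners : Cmd :=
  .loop 3 1 0 (.seq (.setNat 12 (.var 3) (.const 0) (.var 11))
    (.seq (.assign 11 (.add (.var 11) (.const 1)))
      (.cond (.natLe (.var 0) (.var 11)) (.assign 11 (.const 0)))))

/-- The bidder may be put into the slot in variable `6`. -/
def Test.admissible : Test :=
  .and (.realLe (.get 1 (.get 12 (.var 6) (.const 0)) (.sub (.var 13) (.const 1))) (.ofNat (.var 8)))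
    (.natLe (.get 10 (.get 12 (.var 6) (.const 0)) (.sub (.var 13) (.const 1))) (.const 0))

/-- Find an admissible slot `b` with the smallest label; variable `14` becomes `b + 1`, or `0` if
there is none. -/
def findSlot : Cmd :=
  .seq (.assign 14 (.const 0)) (.loop 6 1 0 (.cond
    (.and .admissible (.not (.and (.natLe (.const 1) (.var 14))
      (.natLe (.get 15 (.sub (.var 14) (.const 1)) (.const 0)) (.get 15 (.var 6) (.const 0))))))
    (.assign 14 (.add (.var 6) (.const 1)))))

/-- Put the bidder into the slot found, raise its label, and let the previous holder be the bidder. -/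
def swapBidder : Cmd :=
  .seq (.setNat 15 (.sub (.var 14) (.const 1)) (.const 0)
      (.add (.get 15 (.sub (.var 14) (.const 1)) (.const 0)) (.const 1)))
    (.seq (.assign 17 (.get 16 (.sub (.var 14) (.const 1)) (.const 0)))
      (.seq (.setNat 16 (.sub (.var 14) (.const 1)) (.const 0) (.var 13))
        (.assign 13 (.var 17))))

/-- Let the bidder take the slot found, if there is one. -/
def takeSlot : Cmd := .cond (.natLe (.const 1) (.var 14)) swapBidder

/-- The chores enter one by one, and after each entry there is time for `(m + 1) ^ 2` bids. -/
def auction : Cmd :=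
  .loop 3 1 0 (.seq (.assign 13 (.add (.var 3) (.const 1)))
    (.loop 4 1 1 (.loop 5 1 1 (.cond (.natLe (.const 1) (.var 13)) (.seq findSlot takeSlot)))))

/-- Give the chore held by a slot to the owner of the slot. -/
def readSlots : Cmd :=
  .loop 3 1 0 (.cond (.natLe (.const 1) (.get 16 (.var 3) (.const 0)))
    (.setNat 2 (.sub (.get 16 (.var 3) (.const 0)) (.const 1)) (.const 0)
      (.get 12 (.var 3) (.const 0))))

/-- The allocation by matching. -/
def giveByMatching : Cmd :=
  .seq scale (.seq markBlocked (.seq assignOwners (.seq auction readSlots)))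

/-- With many chores, each goes to an agent who minds it least; with few, they are matched to
slots.

The program uses the following arrays of natural numbers besides those of the input and the
output. Counters are `3`, …, `6`; powers of two are in `7`, the threshold `T` is in `8` and the number
of chores from which on they are considered to be many is in `9`; array `10` marks the blocked pairs,
`11` is the next owner and array `12` holds the owners of slots; `13` is the bidder (plus `1`, or `0` for
none), `14` the slot that it chooses (plus `1`, or `0`), array `15` holds the labels of slots and array
`16` their holders (plus `1`, or `0`), and `17` is an auxiliary variable. The array `1` of reals holds `n`
times the disutilities, which are compared with `T` in place of the disutilities with `T / n`. -/
def allocate (C C' : ℕ) : Cmd :=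
  .seq (thresholds C C') (.ite (.natLe (.var 9) (.var 1)) giveToLeast giveByMatching)

theorem allocate_wellFormed (C C' : ℕ) : (allocate C C').WellFormed := by
  simp [allocate, thresholds, giveToLeast, giveByMatching, scale, markBlocked, assignOwners, auction,
    readSlots, findSlot, takeSlot, swapBidder, Cmd.WellFormed, Cmd.KeepsNat, Cmd.cond, Cmd.assign]

open Cmd

theorem Cmd.run_cond_pos {b : Test} {c : Cmd} {s : Memory} (h : b.Holds s) :
    (Cmd.cond b c).run s = c.run s := by simp [Cmd.cond, run, h]

theorem Cmd.run_cond_neg {b : Test} {c : Cmd} {s : Memory} (h : ¬ b.Holds s) :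
    (Cmd.cond b c).run s = s := by simp [Cmd.cond, run, h]

theorem thresholds_run (C C' : ℕ) {n : ℕ} (hn : 1 ≤ n) {s : Memory} (h0 : s.nat 0 0 0 = n)
    (h8 : s.nat 8 0 0 = 0) (h9 : s.nat 9 0 0 = 0) :
    ((thresholds C C').run s).nat 8 0 0 = C * (Nat.log 2 n + 1) ∧
      ((thresholds C C').run s).nat 9 0 0 = C' * n * (Nat.log 2 n + 1) := by
  rw [thresholds, run]
  set s1 := (Cmd.assign 7 (.const 1)).run s with hs1
  have key := loop_induction (x := 3) (y := 0) (k := 0) (N := n) (s := s1)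
    (c := .cond (.natLe (.var 7) (.var 0))
    (.seq (.assign 7 (.add (.var 7) (.var 7)))
      (.seq (.assign 8 (.add (.var 8) (.const C)))
        (.assign 9 (.add (.var 9) (.smul C' (.var 0)))))))
    (by simp [hs1, Cmd.assign, run, h0])
    (fun r s' => ∃ l ≤ r, s'.nat 7 0 0 = 2 ^ l ∧ s'.nat 8 0 0 = C * l ∧ s'.nat 9 0 0 = C' * n * l ∧
      (2 ^ l ≤ n → l = r) ∧ (l ≠ 0 → 2 ^ (l - 1) ≤ n))
    ⟨0, le_rfl, by simp [hs1, Cmd.assign, run, NatExp.eval, h8, h9]⟩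
    (by
      rintro r hr s' - hk - ⟨l, hl, h7', h8', h9', h1, h2⟩
      have h0' : s'.nat 0 0 0 = n := by
        rw [hk 0 (by simp [KeepsNat, Cmd.cond, Cmd.assign])]; simp [hs1, Cmd.assign, run, h0]
      by_cases hc : 2 ^ l ≤ n
      · obtain rfl := h1 hc
        rw [run_cond_pos (by simp [Test.Holds, h7', h0', hc])]
        refine ⟨l + 1, le_rfl, ?_, ?_, ?_, fun _ => rfl, fun _ => hc⟩
        · simp [Cmd.assign, run, NatExp.eval, h7']; ring
        · simp [Cmd.assign, run, NatExp.eval, h8']; ring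
        · simp [Cmd.assign, run, NatExp.eval, h9', h0']; ring
      · rw [run_cond_neg (by simpa [Test.Holds, h7', h0'] using hc)]
        exact ⟨l, by omega, by simpa using h7', by simpa using h8', by simpa using h9',
          fun h => absurd h hc, h2⟩)
  obtain ⟨l, hl, -, h8', h9', h1, h2⟩ := key
  have hlt : n < 2 ^ l := by
    by_contra! hle
    have := h1 hle
    subst this
    exact absurd hle (not_le.2 l.lt_two_pow_self)
  have hl0 : l ≠ 0 := by rintro rfl; simp at hlt; omega
  have hlog : Nat.log 2 n = l - 1 := by
    rw [Nat.log_eq_iff (by omega)]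
    refine ⟨h2 hl0, ?_⟩
    rwa [show l - 1 + 1 = l by omega]
  rw [hlog, show l - 1 + 1 = l by omega]
  exact ⟨h8', h9'⟩

theorem giveToLeast_run {n m : ℕ} (hn : 1 ≤ n) {s : Memory} (h0 : s.nat 0 0 0 = n)
    (h1 : s.nat 1 0 0 = m) {j : ℕ} (hj : j < m) :
    ∃ b < n, (giveToLeast.run s).nat 2 j 0 = b ∧ ∀ i < n, s.real 0 b j ≤ s.real 0 i j := by
  refine loop_induction (N := m) (by simpa using h1)
    (fun r s' => ∀ j < r, ∃ b < n, s'.nat 2 j 0 = b ∧ ∀ i < n, s.real 0 b j ≤ s.real 0 i j)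
    (by simp) ?_ j hj
  intro r hr s' h3 hk hkr ih j hj
  have hr0 : s'.real 0 = s.real 0 := hkr 0 (by simp [KeepsReal, Cmd.cond])
  rw [run]
  set s1 := (Cmd.setNat 2 (.var 3) (.const 0) (.const 0)).run s' with hs1
  have key := loop_induction (x := 4) (y := 0) (k := 0) (N := n) (s := s1)
    (c := .cond (.realLe (.get 0 (.var 4) (.var 3)) (.get 0 (.get 2 (.var 3) (.const 0)) (.var 3)))
      (.setNat 2 (.var 3) (.const 0) (.var 4)))
    (by
      have : s'.nat 0 0 0 = n := by rw [hk 0 (by simp [KeepsNat, Cmd.cond])]; exact h0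
      simp [hs1, run, this])
    (fun q s'' => (∀ j < r, s''.nat 2 j 0 = s'.nat 2 j 0) ∧
      s''.nat 2 r 0 < n ∧ ∀ i < q, s.real 0 (s''.nat 2 r 0) r ≤ s.real 0 i r)
    (by
      refine ⟨fun j hj => ?_, ?_, by simp⟩
      · simp [hs1, run, h3, hj.ne]
      · simp [hs1, run, h3, NatExp.eval]; omega)
    (by
      rintro q hq s'' h4 hk' hkr' ⟨ih1, ih2, ih3⟩
      have h3' : s''.nat 3 0 0 = r := by
        rw [hk' 3 (by simp [KeepsNat, Cmd.cond])]; simp [hs1, run, h3]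
      have hr0' : s''.real 0 = s.real 0 := by
        rw [hkr' 0 (by simp [KeepsReal, Cmd.cond]), ← hr0]; simp [hs1, run]
      by_cases hc : s.real 0 q r ≤ s.real 0 (s''.nat 2 r 0) r
      · rw [run_cond_pos (by simpa [Test.Holds, RealExp.eval, NatExp.eval, h3', h4, hr0'] using hc)]
        simp only [run, Memory.setNat_nat, NatExp.var_eval, h3', h4, NatExp.eval]
        simp only [Nat.reduceEqDiff, false_and, if_false]
        refine ⟨fun j hj => ?_, by simpa using hq, fun i hi => ?_⟩
        · rw [if_neg (by omega)]; exact ih1 j hj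
        · rw [if_pos (by simp)]
          rcases Nat.lt_succ_iff_lt_or_eq.1 hi with h | rfl
          · exact hc.trans (ih3 i h)
          · exact le_rfl
      · rw [run_cond_neg (by simpa [Test.Holds, RealExp.eval, NatExp.eval, h3', h4, hr0'] using hc)]
        simp only [Memory.setNat_nat]
        simp only [Nat.reduceEqDiff, false_and, if_false]
        refine ⟨ih1, ih2, fun i hi => ?_⟩
        rcases Nat.lt_succ_iff_lt_or_eq.1 hi with h | rfl
        · exact ih3 i h
        · exact (not_le.1 hc).le)
  simp only [Memory.setNat_nat]
  simp only [Nat.reduceEqDiff, false_and, if_false]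
  rcases Nat.lt_succ_iff_lt_or_eq.1 hj with h | rfl
  · rw [key.1 j h]; exact ih j h
  · exact ⟨_, key.2.1, rfl, key.2.2⟩

theorem scale_run {n m : ℕ} {s : Memory} (h0 : s.nat 0 0 0 = n)
    (h1 : s.nat 1 0 0 = m) (hz : ∀ i j, s.real 1 i j = 0) {i j : ℕ} (hi : i < n) (hj : j < m) :
    (scale.run s).real 1 i j = n * s.real 0 i j := by
  have key := loop_induction (x := 3) (y := 0) (k := 0) (N := n) (s := s)
    (c := .loop 4 1 0 (.loop 5 0 0 (.setReal 1 (.var 3) (.var 4)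
      (.add (.get 1 (.var 3) (.var 4)) (.get 0 (.var 3) (.var 4)))))) h0
    (fun r s' => ∀ i j, s'.real 1 i j = if i < r ∧ j < m then n * s.real 0 i j else 0)
    (by simp [hz])
    (by
      intro r hr s1 h3 hk hkr ih
      rw [Memory.setNat_real]
      have key := loop_induction (x := 4) (y := 1) (k := 0) (N := m) (s := s1)
        (c := .loop 5 0 0 (.setReal 1 (.var 3) (.var 4)
          (.add (.get 1 (.var 3) (.var 4)) (.get 0 (.var 3) (.var 4)))))
        (by rw [hk 1 (by simp [KeepsNat])]; exact h1)
        (fun q s' => ∀ i j, s'.real 1 i j =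
          if (i < r ∧ j < m) ∨ (i = r ∧ j < q) then n * s.real 0 i j else 0)
        (by simp [ih])
        (by
          intro q hq s2 h4 hk2 hkr2 ih2
          rw [Memory.setNat_real]
          have key := loop_induction (x := 5) (y := 0) (k := 0) (N := n) (s := s2)
            (c := .setReal 1 (.var 3) (.var 4)
              (.add (.get 1 (.var 3) (.var 4)) (.get 0 (.var 3) (.var 4))))
            (by rw [hk2 0 (by simp [KeepsNat]), hk 0 (by simp [KeepsNat])]; exact h0)
            (fun p s' => ∀ i j, s'.real 1 i j =
              if (i < r ∧ j < m) ∨ (i = r ∧ j < q) then n * s.real 0 i j else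
                if i = r ∧ j = q then p * s.real 0 i j else 0)
            (by simp [ih2])
            (by
              intro p hp s3 h5 hk3 hkr3 ih3 i j
              have e3 : s3.nat 3 0 0 = r := by
                rw [hk3 3 (by simp [KeepsNat]), hk2 3 (by simp [KeepsNat]), h3]
              have e4 : s3.nat 4 0 0 = q := by rw [hk3 4 (by simp [KeepsNat]), h4]
              have e0 : s3.real 0 = s.real 0 := by
                rw [hkr3 0 (by simp [KeepsReal]), hkr2 0 (by simp [KeepsReal]),
                  hkr 0 (by simp [KeepsReal])]
              simp only [run, Memory.setNat_real, Memory.setReal_real, RealExp.eval,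
                NatExp.var_eval, e3, e4, e0, ih3]
              by_cases e : i = r ∧ j = q
              · obtain ⟨rfl, rfl⟩ := e
                simp only [true_and, and_self, if_true, lt_irrefl, false_and, or_false, if_false]
                push_cast; ring
              · simp only [true_and, if_neg e])
          intro i j
          rw [show (loop 5 0 0 (.setReal 1 (.var 3) (.var 4)
            (.add (.get 1 (.var 3) (.var 4)) (.get 0 (.var 3) (.var 4))))).run s2 = _ from rfl, key i j]
          by_cases e : i = r ∧ j = q
          · obtain ⟨rfl, rfl⟩ := e; simp
          · rw [if_neg e]
            have : ((i < r ∧ j < m) ∨ (i = r ∧ j < q)) ↔ ((i < r ∧ j < m) ∨ (i = r ∧ j < q + 1)) := by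
              omega
            simp only [this])
      intro i j
      rw [key i j]
      have : ((i < r ∧ j < m) ∨ (i = r ∧ j < m)) ↔ (i < r + 1 ∧ j < m) := by omega
      simp only [this])
  rw [scale, key i j, if_pos ⟨hi, hj⟩]

/-- A loop whose rounds raise flags raises the union of these flags. -/
theorem loop_flags {x y k N : ℕ} {c : Cmd} {s : Memory} (z : ℕ) (hz : z ≠ x)
    (hN : s.nat y 0 0 + k = N) (G : ℕ → ℕ → ℕ → Prop)
    (body : ∀ r < N, ∀ s' : Memory, s'.nat x 0 0 = r →
      (∀ z, (loop x y k c).KeepsNat z → s'.nat z = s.nat z) →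
      (∀ z, (loop x y k c).KeepsReal z → s'.real z = s.real z) →
      ∀ a b, (c.run s').nat z a b ≠ 0 ↔ s'.nat z a b ≠ 0 ∨ G r a b) (a b : ℕ) :
    ((loop x y k c).run s).nat z a b ≠ 0 ↔ s.nat z a b ≠ 0 ∨ ∃ r < N, G r a b := by
  refine loop_induction hN
    (fun q s' => s'.nat z a b ≠ 0 ↔ s.nat z a b ≠ 0 ∨ ∃ r < q, G r a b) ?_ ?_
  · simp [hz]
  · intro r hr s' hx hk hkr ih
    rw [Memory.setNat_nat_of_ne _ _ _ _ hz, body r hr s' hx hk hkr a b, ih, or_assoc]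
    refine or_congr_right ⟨?_, ?_⟩
    · rintro (⟨q, hq, h⟩ | h)
      · exact ⟨q, by omega, h⟩
      · exact ⟨r, by omega, h⟩
    · rintro ⟨q, hq, h⟩
      rcases Nat.lt_succ_iff_lt_or_eq.1 hq with h' | rfl
      · exact .inl ⟨q, h', h⟩
      · exact .inr h

/-- The scaled disutility at `(i, j)` is at most three times the threshold. -/
def Memory.Near (s : Memory) (i j : ℕ) : Prop := s.real 1 i j ≤ 3 * (s.nat 8 0 0 : ℝ)

theorem markBlocked_run {n m : ℕ} {s : Memory} (h0 : s.nat 0 0 0 = n)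
    (h1 : s.nat 1 0 0 = m) (hz : ∀ i j, s.nat 10 i j = 0) {i j : ℕ} (hi : i < n) (hj : j < m) :
    (markBlocked.run s).nat 10 i j = 0 ↔ ¬ ∃ p < n, ∃ k < m, i ≠ p ∧ j ≠ k ∧
      s.Near i j ∧ s.Near i k ∧ s.Near p j ∧ s.Near p k := by
  rw [← not_iff_not, not_not, ← ne_eq, markBlocked, loop_flags 10 (by norm_num) h0
    (fun r a b => ∃ q < m, ∃ p < n, ∃ k < m, a = r ∧ b = q ∧ a ≠ p ∧ b ≠ k ∧
      s.Near a b ∧ s.Near a k ∧ s.Near p b ∧ s.Near p k)]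
  · simp only [hz, ne_eq, not_true, false_or]
    constructor
    · rintro ⟨_, -, _, -, p, hp, k, hk, rfl, rfl, h⟩
      exact ⟨p, hp, k, hk, h⟩
    · rintro ⟨p, hp, k, hk, h⟩
      exact ⟨i, hi, j, hj, p, hp, k, hk, rfl, rfl, h⟩
  · intro r hr s1 h3 hk1 hr1
    apply loop_flags 10 (by norm_num)
    · rw [hk1 1 (by simp [KeepsNat, Cmd.cond])]; exact h1
    · intro q hq s2 h4 hk2 hr2
      apply loop_flags 10 (by norm_num)
      · rw [hk2 0 (by simp [KeepsNat, Cmd.cond]), hk1 0 (by simp [KeepsNat, Cmd.cond])]; exact h0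
      · intro p hp s3 h5 hk3 hr3
        apply loop_flags 10 (by norm_num)
        · rw [hk3 1 (by simp [KeepsNat, Cmd.cond]), hk2 1 (by simp [KeepsNat, Cmd.cond]),
            hk1 1 (by simp [KeepsNat, Cmd.cond])]; exact h1
        · intro k hk s4 h6 hk4 hr4 a b
          have e3 : s4.nat 3 0 0 = r := by
            rw [hk4 3 (by simp [KeepsNat, Cmd.cond]), hk3 3 (by simp [KeepsNat, Cmd.cond]),
              hk2 3 (by simp [KeepsNat, Cmd.cond]), h3]
          have e4 : s4.nat 4 0 0 = q := by
            rw [hk4 4 (by simp [KeepsNat, Cmd.cond]), hk3 4 (by simp [KeepsNat, Cmd.cond]), h4]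
          have e5 : s4.nat 5 0 0 = p := by rw [hk4 5 (by simp [KeepsNat, Cmd.cond]), h5]
          have e8 : s4.nat 8 = s.nat 8 := by
            rw [hk4 8 (by simp [KeepsNat, Cmd.cond]), hk3 8 (by simp [KeepsNat, Cmd.cond]),
              hk2 8 (by simp [KeepsNat, Cmd.cond]), hk1 8 (by simp [KeepsNat, Cmd.cond])]
          have er : s4.real 1 = s.real 1 := by
            rw [hr4 1 (by simp [KeepsReal, Cmd.cond]), hr3 1 (by simp [KeepsReal, Cmd.cond]),
              hr2 1 (by simp [KeepsReal, Cmd.cond]), hr1 1 (by simp [KeepsReal, Cmd.cond])]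
          have near : ∀ u v : NatExp, (Test.near u v).Holds s4 ↔
              s.Near (u.eval s4) (v.eval s4) := by
            intro u v
            simp only [Test.near, Test.Holds, RealExp.eval, NatExp.eval, NatExp.var_eval, e8, er,
              Memory.Near]
            push_cast
            rw [show (s.nat 8 0 0 : ℝ) + (s.nat 8 0 0 + s.nat 8 0 0) = 3 * s.nat 8 0 0 by ring]
          have ne : ∀ u v : NatExp, (Test.ne u v).Holds s4 ↔ u.eval s4 ≠ v.eval s4 := by
            intro u v; simp only [Test.ne, Test.Holds]; omega
          by_cases hc : r ≠ p ∧ q ≠ k ∧ s.Near r q ∧ s.Near r k ∧ s.Near p q ∧ s.Near p k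
          · rw [run_cond_pos (by
              simp only [Test.Holds, near, ne, NatExp.var_eval, e3, e4, e5, h6]; tauto)]
            simp only [run, Memory.setNat_nat, NatExp.var_eval, e3, e4, NatExp.eval, true_and]
            by_cases e : a = r ∧ b = q
            · obtain ⟨rfl, rfl⟩ := e
              simpa using .inr hc
            · rw [if_neg e]
              exact ⟨.inl, fun h => h.resolve_right fun h => e ⟨h.1, h.2.1⟩⟩
          · rw [run_cond_neg (by
              simp only [Test.Holds, near, ne, NatExp.var_eval, e3, e4, e5, h6]; tauto)]
            refine ⟨.inl, fun h => h.resolve_right ?_⟩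
            rintro ⟨rfl, rfl, h'⟩
            exact hc h'

theorem assignOwners_run {n m : ℕ} (hn : 1 ≤ n) {s : Memory} (h0 : s.nat 0 0 0 = n)
    (h1 : s.nat 1 0 0 = m) (hz : s.nat 11 0 0 = 0) {σ : ℕ} (hσ : σ < m) :
    (assignOwners.run s).nat 12 σ 0 = σ % n := by
  refine (loop_induction (by simpa using h1)
    (fun r s' => s'.nat 11 0 0 = r % n ∧ ∀ σ < r, s'.nat 12 σ 0 = σ % n)
    (by simp [hz]) ?_).2 σ hσ
  rintro r hr s' h3 hk hkr ⟨ih1, ih2⟩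
  have h0' : s'.nat 0 0 0 = n := by
    rw [hk 0 (by simp [KeepsNat, Cmd.cond, Cmd.assign])]; exact h0
  have e12 : ∀ σ < r + 1, (if σ = r then r % n else s'.nat 12 σ 0) = σ % n := by
    intro σ hσ
    split_ifs with h
    · rw [h]
    · exact ih2 σ (by omega)
  have hlt := Nat.mod_lt r hn
  simp only [run]
  by_cases hc : n ≤ r % n + 1
  · rw [run_cond_pos (by simp [Test.Holds, Cmd.assign, run, NatExp.eval, h0', ih1, hc])]
    refine ⟨?_, ?_⟩
    · simp only [Cmd.assign, run, NatExp.eval, Memory.setNat_nat]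
      simp only [Nat.reduceEqDiff, false_and, if_false, and_self, if_true]
      have : r % n + 1 = n := by omega
      rw [← Nat.mod_add_mod, this, Nat.mod_self]
    · simpa [Cmd.assign, run, NatExp.eval, h3, ih1] using e12
  · rw [run_cond_neg (by simpa [Test.Holds, Cmd.assign, run, NatExp.eval, h0', ih1] using hc)]
    refine ⟨?_, ?_⟩
    · simp only [Cmd.assign, run, NatExp.eval, Memory.setNat_nat]
      simp [ih1]
      rw [← Nat.mod_add_mod, Nat.mod_eq_of_lt (by omega : r % n + 1 < n)]
    · simpa [Cmd.assign, run, NatExp.eval, h3, ih1] using e12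

/-- Chore `j` may be put into slot `σ`, as far as the contents of the memory tell. -/
def Memory.Admissible (s : Memory) (j σ : ℕ) : Prop :=
  s.real 1 (s.nat 12 σ 0) j ≤ s.nat 8 0 0 ∧ s.nat 10 (s.nat 12 σ 0) j = 0

theorem Memory.admissible_congr {s s' : Memory} (hr : s'.real 1 = s.real 1)
    (h12 : s'.nat 12 = s.nat 12) (h8 : s'.nat 8 = s.nat 8) (h10 : s'.nat 10 = s.nat 10) :
    s'.Admissible = s.Admissible := by
  ext j σ; simp only [Memory.Admissible, hr, h12, h8, h10]

theorem findSlot_run {m j : ℕ} {s : Memory} (h1 : s.nat 1 0 0 = m) (h13 : s.nat 13 0 0 = j + 1) :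
    ((findSlot.run s).nat 14 0 0 = 0 ∧ ∀ σ < m, ¬ s.Admissible j σ) ∨
      ∃ b < m, (findSlot.run s).nat 14 0 0 = b + 1 ∧ s.Admissible j b ∧
        ∀ σ < m, s.Admissible j σ → s.nat 15 b 0 ≤ s.nat 15 σ 0 := by
  rw [findSlot, run]
  set s1 := (Cmd.assign 14 (.const 0)).run s with hs1
  have hs1n : ∀ z, z ≠ 14 → s1.nat z = s.nat z := fun z hz => s.setNat_nat_of_ne _ _ _ hz
  have hs1r : s1.real = s.real := rfl
  refine loop_induction (N := m) (by simpa [hs1n 1 (by norm_num)] using h1)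
    (fun q s' => (s'.nat 14 0 0 = 0 ∧ ∀ σ < q, ¬ s.Admissible j σ) ∨
      ∃ b < q, s'.nat 14 0 0 = b + 1 ∧ s.Admissible j b ∧
        ∀ σ < q, s.Admissible j σ → s.nat 15 b 0 ≤ s.nat 15 σ 0)
    (by simp [hs1, Cmd.assign, run, NatExp.eval]) ?_
  intro q hq s' h6 hk hkr ih
  have keep : ∀ z, z ≠ 14 → z ≠ 6 → s'.nat z = s.nat z := fun z hz hz' => by
    rw [hk z (by simp [KeepsNat, Cmd.cond, Cmd.assign, hz, hz']), hs1n z hz]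
  have hr1 : s'.real 1 = s.real 1 := by
    rw [hkr 1 (by simp [KeepsReal, Cmd.cond, Cmd.assign]), hs1r]
  have hadm : Test.admissible.Holds s' ↔ s.Admissible j q := by
    simp only [Test.admissible, Test.Holds, RealExp.eval, NatExp.eval, NatExp.var_eval, h6,
      keep 12 (by norm_num) (by norm_num), keep 13 (by norm_num) (by norm_num), h13,
      keep 8 (by norm_num) (by norm_num), keep 10 (by norm_num) (by norm_num), hr1,
      Memory.Admissible, Nat.add_sub_cancel, Nat.le_zero]
  have h15 := keep 15 (by norm_num) (by norm_num)
  by_cases hc : s.Admissible j q ∧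
      ¬ (1 ≤ s'.nat 14 0 0 ∧ s.nat 15 (s'.nat 14 0 0 - 1) 0 ≤ s.nat 15 q 0)
  · rw [run_cond_pos (by simpa only [Test.Holds, hadm, NatExp.eval, NatExp.var_eval, h15, h6] using hc)]
    refine .inr ⟨q, by omega, by simp [Cmd.assign, run, NatExp.eval, h6], hc.1, fun σ hσ hR => ?_⟩
    rcases Nat.lt_succ_iff_lt_or_eq.1 hσ with h | rfl
    · rcases ih with ⟨-, ih⟩ | ⟨b, hb, e, hbR, ih⟩
      · exact absurd hR (ih σ h)
      · have h2 := hc.2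
        rw [e, Nat.add_sub_cancel] at h2
        have := ih σ h hR
        omega
    · exact le_rfl
  · rw [run_cond_neg (by simpa only [Test.Holds, hadm, NatExp.eval, NatExp.var_eval, h15, h6] using hc),
      Memory.setNat_nat_of_ne _ _ _ _ (by norm_num)]
    rcases ih with ⟨e, ih⟩ | ⟨b, hb, e, hbR, ih⟩
    · refine .inl ⟨e, fun σ hσ hR => ?_⟩
      rcases Nat.lt_succ_iff_lt_or_eq.1 hσ with h | rfl
      · exact ih σ h hR
      · exact hc ⟨hR, by omega⟩
    · refine .inr ⟨b, by omega, e, hbR, fun σ hσ hR => ?_⟩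
      rcases Nat.lt_succ_iff_lt_or_eq.1 hσ with h | rfl
      · exact ih σ h hR
      · rw [e, Nat.add_sub_cancel] at hc
        by_contra hlt
        exact hc ⟨hR, fun h => hlt h.2⟩

/-- The state of the auction stored in the memory, for the admissibility relation `R`. -/
def Memory.Auction (s : Memory) (m : ℕ) (R : ℕ → ℕ → Prop) (u : ℕ) : Prop :=
  AuctionState m R u (fun σ => s.nat 16 σ 0) (fun σ => s.nat 15 σ 0) (s.nat 13 0 0)

/-- Each bid raises one label by `1`. -/
theorem bid_run {m u : ℕ} {s : Memory} (h1 : s.nat 1 0 0 = m) (hs : s.Auction m s.Admissible u)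
    (hc : s.nat 13 0 0 ≠ 0) (hu : u ≤ m) (hall : HallCondition m s.Admissible) :
    ((Cmd.seq findSlot takeSlot).run s).Auction m s.Admissible u ∧
      ∑ σ ∈ Finset.range m, ((Cmd.seq findSlot takeSlot).run s).nat 15 σ 0 =
        ∑ σ ∈ Finset.range m, s.nat 15 σ 0 + 1 := by
  obtain ⟨j, hj⟩ := Nat.exists_eq_succ_of_ne_zero hc
  rw [Memory.Auction, hj] at hs
  obtain ⟨σ, hσ, hR, hlt⟩ := hs.exists_slot hu hall
  rw [run]
  have keep : ∀ z, z ≠ 14 → z ≠ 6 → (findSlot.run s).nat z = s.nat z := fun z hz hz' =>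
    run_nat (by simp [findSlot, KeepsNat, Cmd.cond, Cmd.assign, hz, hz']) s
  have h13 := congr_fun (congr_fun (keep 13 (by norm_num) (by norm_num)) 0) 0
  have h15 := keep 15 (by norm_num) (by norm_num)
  have h16 := keep 16 (by norm_num) (by norm_num)
  rcases findSlot_run h1 hj with ⟨-, h⟩ | ⟨b, hb, e, hbR, hmin⟩
  · exact absurd hR (h σ hσ)
  · generalize findSlot.run s = s1 at *
    rw [takeSlot, run_cond_pos (by simp [Test.Holds, NatExp.eval, e])]
    have e15 : ∀ σ, (swapBidder.run s1).nat 15 σ 0 =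
        Function.update (fun σ => s.nat 15 σ 0) b (s.nat 15 b 0 + 1) σ := by
      intro σ
      simp [swapBidder, Cmd.assign, run, NatExp.eval, e, h15, Function.update_apply]
    have e16 : ∀ σ, (swapBidder.run s1).nat 16 σ 0 =
        Function.update (fun σ => s.nat 16 σ 0) b (j + 1) σ := by
      intro σ
      simp [swapBidder, Cmd.assign, run, NatExp.eval, e, h16, h13, hj, Function.update_apply]
    have e13 : (swapBidder.run s1).nat 13 0 0 = s.nat 16 b 0 := by
      simp [swapBidder, Cmd.assign, run, NatExp.eval, e, h16]
    refine ⟨?_, ?_⟩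
    · rw [Memory.Auction, funext e15, funext e16, e13]
      exact hs.bid hb hbR ((hmin σ hσ hR).trans_lt hlt) hmin
    · rw [Finset.sum_congr rfl fun σ _ => e15 σ,
        Finset.sum_update_of_mem (Finset.mem_range.2 hb),
        ← Finset.add_sum_erase _ _ (Finset.mem_range.2 hb), Finset.sdiff_singleton_eq_erase]
      ring

/-- Under Hall's condition the auction ends with every chore in an admissible slot. -/
theorem auction_run {m : ℕ} {s : Memory} (h1 : s.nat 1 0 0 = m) (h13 : s.nat 13 0 0 = 0)
    (h15 : ∀ σ, s.nat 15 σ 0 = 0) (h16 : ∀ σ, s.nat 16 σ 0 = 0)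
    (hall : HallCondition m s.Admissible) :
    (auction.run s).Auction m s.Admissible m ∧ (auction.run s).nat 13 0 0 = 0 := by
  refine loop_induction (N := m) (by simpa using h1)
    (fun r s' => s'.Auction m s.Admissible r ∧ s'.nat 13 0 0 = 0) ?_ ?_
  · refine ⟨?_, by simpa using h13⟩
    simp only [Memory.Auction, Memory.setNat_nat]
    constructor <;> simp [h13, h15, h16]
  · rintro r hr s1 h3 hk1 hr1 ⟨ih1, ih2⟩
    rw [run]
    set s2 := (Cmd.assign 13 (.add (.var 3) (.const 1))).run s1 with hs2
    have keep2 : ∀ z, z ≠ 13 → s2.nat z = s1.nat z := fun z hz => s1.setNat_nat_of_ne _ _ _ hz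
    have adm2 : s2.Admissible = s.Admissible := by
      apply Memory.admissible_congr
      · exact hr1 1 (by simp [KeepsReal, findSlot, takeSlot, swapBidder, Cmd.cond, Cmd.assign])
      all_goals
        rw [keep2 _ (by norm_num)]
        exact hk1 _ (by simp [KeepsNat, findSlot, takeSlot, swapBidder, Cmd.cond, Cmd.assign])
    have start : s2.Auction m s.Admissible (r + 1) := by
      have e13 : s2.nat 13 0 0 = r + 1 := by simp [hs2, Cmd.assign, run, NatExp.eval, h3]
      rw [Memory.Auction, e13, keep2 15 (by norm_num), keep2 16 (by norm_num)]
      rw [Memory.Auction, ih2] at ih1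
      exact ih1.enter
    have h12 : s2.nat 1 0 0 = m := by
      rw [keep2 _ (by norm_num), hk1 _ (by simp [KeepsNat, findSlot, takeSlot, swapBidder, Cmd.cond, Cmd.assign])]
      exact h1
    have key := loop_induction (x := 4) (y := 1) (k := 1) (N := m + 1) (s := s2)
      (c := .loop 5 1 1 (.cond (.natLe (.const 1) (.var 13)) (.seq findSlot takeSlot)))
      (by rw [h12])
      (fun p s' => s'.Auction m s.Admissible (r + 1) ∧
        (s'.nat 13 0 0 = 0 ∨ p * (m + 1) ≤ ∑ σ ∈ Finset.range m, s'.nat 15 σ 0))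
      ⟨start, .inr (by simp)⟩
      (by
        intro p hp s3 _ hk3 hr3 ih3
        have h13' : s3.nat 1 0 0 = m := by
          rw [hk3 1 (by simp [KeepsNat, findSlot, takeSlot, swapBidder, Cmd.cond, Cmd.assign])]; exact h12
        have key := loop_induction (x := 5) (y := 1) (k := 1) (N := m + 1) (s := s3)
          (c := .cond (.natLe (.const 1) (.var 13)) (.seq findSlot takeSlot))
          (by rw [h13'])
          (fun q s' => s'.Auction m s.Admissible (r + 1) ∧
            (s'.nat 13 0 0 = 0 ∨ p * (m + 1) + q ≤ ∑ σ ∈ Finset.range m, s'.nat 15 σ 0))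
          ih3
          (by
            rintro q hq s4 - hk4 hr4 ⟨ih4, ih4'⟩
            have adm4 : s4.Admissible = s.Admissible := by
              rw [← adm2]
              apply Memory.admissible_congr
              · rw [hr4 _ (by simp [KeepsReal, findSlot, takeSlot, swapBidder, Cmd.cond, Cmd.assign]),
                  hr3 _ (by simp [KeepsReal, findSlot, takeSlot, swapBidder, Cmd.cond, Cmd.assign])]
              all_goals
                rw [hk4 _ (by simp [KeepsNat, findSlot, takeSlot, swapBidder, Cmd.cond, Cmd.assign]),
                  hk3 _ (by simp [KeepsNat, findSlot, takeSlot, swapBidder, Cmd.cond, Cmd.assign])]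
            have h14 : s4.nat 1 0 0 = m := by
              rw [hk4 1 (by simp [KeepsNat, findSlot, takeSlot, swapBidder, Cmd.cond, Cmd.assign])]; exact h13'
            by_cases hc : s4.nat 13 0 0 = 0
            · rw [run_cond_neg (by simp [Test.Holds, NatExp.eval, hc])]
              exact ⟨ih4, .inl hc⟩
            · rw [run_cond_pos (by simp [Test.Holds, NatExp.eval]; omega)]
              rw [← adm4] at ih4 hall ⊢
              obtain ⟨b1, b2⟩ := bid_run h14 ih4 hc (by omega) hall
              refine ⟨b1, .inr ?_⟩
              have h := ih4'.resolve_left hc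
              change _ ≤ ∑ σ ∈ Finset.range m, ((Cmd.seq findSlot takeSlot).run s4).nat 15 σ 0
              omega)
        rwa [Nat.succ_mul])
    generalize (loop 4 1 1 _).run s2 = s5 at key ⊢
    refine ⟨key.1, key.2.resolve_right fun h => ?_⟩
    have hle : ∑ σ ∈ Finset.range m, s5.nat 15 σ 0 ≤ ∑ σ ∈ Finset.range m, m :=
      Finset.sum_le_sum fun σ hσ => key.1.label_le σ (Finset.mem_range.1 hσ)
    simp only [Finset.sum_const, Finset.card_range, smul_eq_mul] at hle
    nlinarith

theorem readSlots_run {m : ℕ} {s : Memory} (h1 : s.nat 1 0 0 = m)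
    (hinj : ∀ σ < m, ∀ σ' < m, s.nat 16 σ 0 = s.nat 16 σ' 0 → s.nat 16 σ 0 ≠ 0 → σ = σ')
    {σ j : ℕ} (hσ : σ < m) (hj : s.nat 16 σ 0 = j + 1) :
    (readSlots.run s).nat 2 j 0 = s.nat 12 σ 0 := by
  refine loop_induction (N := m) (by simpa using h1)
    (fun r s' => ∀ σ < r, ∀ j, s.nat 16 σ 0 = j + 1 → s'.nat 2 j 0 = s.nat 12 σ 0)
    (by simp) ?_ σ hσ j hj
  intro r hr s' h3 hk _ ih σ hσ j hj
  have e16 : s'.nat 16 = s.nat 16 := hk 16 (by simp [KeepsNat, Cmd.cond])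
  have e12 : s'.nat 12 = s.nat 12 := hk 12 (by simp [KeepsNat, Cmd.cond])
  by_cases hc : 1 ≤ s.nat 16 r 0
  · rw [run_cond_pos (by simpa [Test.Holds, NatExp.eval, h3, e16] using hc)]
    simp only [run, NatExp.eval, NatExp.var_eval, h3, e16, e12, Memory.setNat_nat]
    simp only [Nat.reduceEqDiff, false_and, if_false, true_and, and_true]
    split_ifs with h
    · rw [hinj σ (by omega) r hr (by omega) (by omega)]
    · rcases Nat.lt_succ_iff_lt_or_eq.1 hσ with h' | rfl
      · exact ih σ h' j hj
      · omega
  · rw [run_cond_neg (by simpa [Test.Holds, NatExp.eval, h3, e16] using hc)]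
    rcases Nat.lt_succ_iff_lt_or_eq.1 hσ with h' | rfl
    · simpa using ih σ h' j hj
    · omega

/-! ### Envy-freeness of the two allocations -/

/-- The pair `(i, j)` lies in a rectangle of two agents and two chores whose four disutilities are at
most `t`. -/
def Blocked {n m : ℕ} (d : Fin n → Fin m → ℝ) (t : ℝ) (i : Fin n) (j : Fin m) : Prop :=
  ∃ p, i ≠ p ∧ ∃ k, j ≠ k ∧ d i j ≤ t ∧ d i k ≤ t ∧ d p j ≤ t ∧ d p k ≤ t

/-- Agent `i` may receive chore `j` in the allocation by matching with threshold `τ`. -/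
def Acceptable {n m : ℕ} (d : Fin n → Fin m → ℝ) (τ : ℝ) (i : Fin n) (j : Fin m) : Prop :=
  d i j ≤ τ ∧ ¬ Blocked d (3 * τ) i j

/-- The number of slots of agent `i` when the slots `0, …, m - 1` are dealt to the agents in
turns. -/
def slotCount (m n i : ℕ) : ℕ := ((Finset.range m).filter fun σ => σ % n = i).card

/-- Hall's condition for matching the chores to the slots of agents to whom they are acceptable. -/
def AgentHall {n m : ℕ} (d : Fin n → Fin m → ℝ) (τ : ℝ) : Prop :=
  ∀ S : Finset (Fin m), ∀ N : Finset (Fin n), (∀ i, ∀ j ∈ S, Acceptable d τ i j → i ∈ N) →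
    S.card ≤ ∑ i ∈ N, slotCount m n i

theorem slotCount_eq {m n i : ℕ} (hi : i < n) :
    slotCount m n i = m / n + if i < m % n then 1 else 0 := by
  have h := Nat.count_modEq_card m (by omega : 0 < n) i
  rw [Nat.count_eq_card_filter_range, Nat.mod_eq_of_lt hi] at h
  rw [slotCount, ← h]
  congr 1
  ext σ
  simp only [Finset.mem_filter, Nat.ModEq, Nat.mod_eq_of_lt hi]

theorem le_slotCount {m n i : ℕ} (hi : i < n) : m / n ≤ slotCount m n i := by
  rw [slotCount_eq hi]; omega

theorem slotCount_le {m n i : ℕ} (hi : i < n) : slotCount m n i ≤ m / n + 1 := by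
  rw [slotCount_eq hi]; split_ifs <;> omega

theorem sum_slotCount {m n : ℕ} (N : Finset (Fin n)) :
    ∑ i ∈ N, slotCount m n i =
      ((Finset.range m).filter fun σ => ∃ i ∈ N, σ % n = i).card := by
  simp only [slotCount]
  rw [← Finset.card_biUnion]
  · congr 1
    ext σ
    simp only [Finset.mem_biUnion, Finset.mem_filter]
    tauto
  · intro i _ i' _ hne
    rw [Function.onFun, Finset.disjoint_left]
    intro σ h1 h2
    simp only [Finset.mem_filter] at h1 h2
    exact hne (Fin.ext (h1.2.symm.trans h2.2))

theorem sum_slotCount_univ {m n : ℕ} (hn : 1 ≤ n) : ∑ i : Fin n, slotCount m n i = m := by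
  rw [sum_slotCount, Finset.filter_true_of_mem, Finset.card_range]
  exact fun σ _ => ⟨⟨σ % n, Nat.mod_lt _ hn⟩, Finset.mem_univ _, rfl⟩

/-- Every bundle consists of `m / n` or `m / n + 1` chores of disutility at most `τ` for its owner.
As no acceptable pair lies in a rectangle of disutilities at most `3 * τ`, an agent `i` has at most one
chore of disutility at most `3 * τ` in the bundle of somebody else, so that this bundle costs `i` at
least `(m / n - 1) * 3 * τ ≥ (m / n + 1) * τ`. -/
theorem isEnvyFree_of_acceptable {n m : ℕ} {d : Fin n → Fin m → ℝ} {τ : ℝ} (hn : 1 ≤ n)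
    (hm : 2 * n ≤ m) (hd : ∀ i j, 0 ≤ d i j) (hτ : 0 ≤ τ) {owner : Fin m → Fin n}
    (hacc : ∀ j, Acceptable d τ (owner j) j)
    (hcard : ∀ i, (Finset.univ.filter fun j => owner j = i).card = slotCount m n i) :
    IsEnvyFree d fun i => Finset.univ.filter fun j => owner j = i := by
  intro i i'
  rcases eq_or_ne i i' with rfl | hne
  · exact le_rfl
  have hq : 2 ≤ m / n := (Nat.le_div_iff_mul_le hn).2 hm
  set q := m / n with hqdef
  have hq' : (2 : ℝ) ≤ q := by exact_mod_cast hq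
  have upper : bundleCost d i (Finset.univ.filter fun j => owner j = i) ≤ (q + 1) * τ := by
    calc bundleCost d i (Finset.univ.filter fun j => owner j = i)
        ≤ ∑ j ∈ Finset.univ.filter (fun j => owner j = i), τ := by
          refine Finset.sum_le_sum fun j hj => ?_
          have := (hacc j).1
          rwa [(Finset.mem_filter.1 hj).2] at this
      _ = slotCount m n i * τ := by rw [Finset.sum_const, hcard, nsmul_eq_mul]
      _ ≤ (q + 1) * τ := by
          gcongr
          exact_mod_cast slotCount_le i.2
  refine upper.trans ?_
  set B := Finset.univ.filter fun j => owner j = i' with hB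
  have hsmall : (B.filter fun j => d i j ≤ 3 * τ).card ≤ 1 := by
    rw [Finset.card_le_one]
    intro j hj k hk
    by_contra hjk
    simp only [hB, Finset.mem_filter, Finset.mem_univ, true_and] at hj hk
    have h1 := hacc j
    have h2 := hacc k
    rw [hj.1] at h1
    rw [hk.1] at h2
    exact h1.2 ⟨i, hne.symm, k, hjk, by linarith [h1.1], by linarith [h2.1], hj.2, hk.2⟩
  have hlarge : q - 1 ≤ (B.filter fun j => ¬ d i j ≤ 3 * τ).card := by
    have h1 := Finset.card_filter_add_card_filter_not (s := B) (fun j => d i j ≤ 3 * τ)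
    have h2 : q ≤ B.card := (le_slotCount i'.2).trans (hcard i').ge
    omega
  calc ((q : ℝ) + 1) * τ ≤ ((q - 1 : ℕ) : ℝ) * (3 * τ) := by
        rw [Nat.cast_sub (by omega)]; push_cast; nlinarith
    _ ≤ (B.filter fun j => ¬ d i j ≤ 3 * τ).card * (3 * τ) := by
        gcongr
    _ = ∑ j ∈ B.filter (fun j => ¬ d i j ≤ 3 * τ), 3 * τ := by rw [Finset.sum_const, nsmul_eq_mul]
    _ ≤ ∑ j ∈ B.filter (fun j => ¬ d i j ≤ 3 * τ), d i j :=
        Finset.sum_le_sum fun j hj => (not_le.1 (Finset.mem_filter.1 hj).2).le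
    _ ≤ bundleCost d i B :=
        Finset.sum_le_sum_of_subset_of_nonneg (Finset.filter_subset _ _) fun j _ _ => hd i j

open Classical in
/-- A bound for the envy of agent `i` towards agent `i'` caused by a chore with disutilities `x` that
is given to an agent who minds it least. The two conditions differ in the treatment of ties, so that
the bound holds however ties are broken. -/
noncomputable def envyBound {n : ℕ} (i i' : Fin n) (x : Fin n → ℝ) : ℝ :=
  (if ∀ k, x i ≤ x k then x i else 0) - if ∀ k, k ≠ i' → x i' < x k then x i else 0

theorem isEnvyFree_of_least {n m : ℕ} {d : Fin n → Fin m → ℝ} (hd : ∀ i j, 0 ≤ d i j)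
    {owner : Fin m → Fin n} (hleast : ∀ j i, d (owner j) j ≤ d i j)
    (hsum : ∀ i i', i ≠ i' → ∑ j, envyBound i i' (fun k => d k j) ≤ 0) :
    IsEnvyFree d fun i => Finset.univ.filter fun j => owner j = i := by
  intro i i'
  rcases eq_or_ne i i' with rfl | hne
  · exact le_rfl
  rw [← sub_nonpos]
  refine le_trans ?_ (hsum i i' hne)
  simp only [bundleCost, Finset.sum_filter]
  rw [← Finset.sum_sub_distrib]
  refine Finset.sum_le_sum fun j _ => ?_
  rw [envyBound]
  refine sub_le_sub ?_ ?_
  · by_cases h : owner j = i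
    · rw [if_pos h, if_pos fun k => h ▸ hleast j k]
    · rw [if_neg h]; split_ifs
      · exact hd i j
      · exact le_rfl
  · by_cases h : owner j = i'
    · rw [if_pos h]; split_ifs
      · exact le_rfl
      · exact hd i j
    · rw [if_neg h, if_neg]
      exact fun hlt => absurd (hlt _ h) (not_lt.2 (hleast j i'))

theorem outputBundles_eq {n m : ℕ} {s : Memory} {owner : Fin m → Fin n}
    (h : ∀ j : Fin m, s.nat 2 j 0 = owner j) :
    outputBundles n m s = fun i => Finset.univ.filter fun j => owner j = i := by
  ext i j
  simp [outputBundles, h, Fin.ext_iff]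

theorem isAllocation_of_owner {n m : ℕ} (owner : Fin m → Fin n) :
    IsAllocation fun i => Finset.univ.filter fun j => owner j = i := by
  refine ⟨fun i i' hne => ?_, fun j => ⟨owner j, by simp⟩⟩
  rw [Finset.disjoint_left]
  intro j h1 h2
  simp only [Finset.mem_filter, Finset.mem_univ, true_and] at h1 h2
  exact hne (h1.symm.trans h2)

/-! ### Correctness of the program -/

theorem giveByMatching_run {n m : ℕ} (hn : 1 ≤ n) {T : ℕ} {d : Fin n → Fin m → ℝ} {s : Memory}
    (h0 : s.nat 0 0 0 = n) (h1 : s.nat 1 0 0 = m) (h8 : s.nat 8 0 0 = T)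
    (hz : ∀ z, 10 ≤ z → s.nat z = 0) (hr : ∀ i : Fin n, ∀ j : Fin m, s.real 0 i j = d i j)
    (hr1 : s.real 1 = 0) (hall : AgentHall d ((T : ℝ) / n)) :
    ∃ owner : Fin m → Fin n, (∀ j : Fin m, (giveByMatching.run s).nat 2 j 0 = owner j) ∧
      (∀ j, Acceptable d ((T : ℝ) / n) (owner j) j) ∧
      ∀ i, (Finset.univ.filter fun j => owner j = i).card = slotCount m n i := by
  have hn' : (0 : ℝ) < n := by exact_mod_cast hn
  simp only [giveByMatching, run]
  set s1 := scale.run s with hs1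
  set s2 := markBlocked.run s1 with hs2
  set s3 := assignOwners.run s2 with hs3
  have k1 : ∀ z, z ∉ [3, 4, 5] → s1.nat z = s.nat z := fun z hz => by
    simp only [List.mem_cons, List.not_mem_nil, or_false, not_or] at hz
    exact run_nat (by simp [scale, KeepsNat, hz]) s
  have k2 : ∀ z, z ∉ [3, 4, 5, 6, 10] → s2.nat z = s1.nat z := fun z hz => by
    simp only [List.mem_cons, List.not_mem_nil, or_false, not_or] at hz
    exact run_nat (by simp [markBlocked, KeepsNat, Cmd.cond, hz]) s1
  have k3 : ∀ z, z ∉ [3, 11, 12] → s3.nat z = s2.nat z := fun z hz => by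
    simp only [List.mem_cons, List.not_mem_nil, or_false, not_or] at hz
    exact run_nat (by simp [assignOwners, KeepsNat, Cmd.cond, Cmd.assign, hz]) s2
  have r2 : s2.real = s1.real := by
    ext1 z; exact run_real (by simp [markBlocked, KeepsReal, Cmd.cond]) s1
  have r3 : s3.real = s2.real := by
    ext1 z; exact run_real (by simp [assignOwners, KeepsReal, Cmd.cond, Cmd.assign]) s2
  have hscale : ∀ i : Fin n, ∀ j : Fin m, s1.real 1 i j = n * d i j := fun i j => by
    rw [hs1, scale_run h0 h1 (by simp [hr1]) i.2 j.2, hr]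
  have small1 : ∀ (i : Fin n) (j : Fin m), s1.real 1 i j ≤ T ↔ d i j ≤ (T : ℝ) / n := fun i j => by
    rw [hscale, le_div_iff₀ hn', mul_comm]
  have near1 : ∀ (i : Fin n) (j : Fin m), s1.Near i j ↔ d i j ≤ 3 * ((T : ℝ) / n) := fun i j => by
    rw [Memory.Near, hscale, k1 8 (by simp), h8, ← mul_div_assoc, le_div_iff₀ hn', mul_comm]
  have blocked2 : ∀ (i : Fin n) (j : Fin m),
      s2.nat 10 i j = 0 ↔ ¬ Blocked d (3 * ((T : ℝ) / n)) i j := fun i j => by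
    rw [hs2, markBlocked_run (by rw [k1 0 (by simp)]; exact h0) (by rw [k1 1 (by simp)]; exact h1)
      (by rw [k1 10 (by simp), hz 10 le_rfl]; simp) i.2 j.2, Blocked]
    refine not_congr ⟨?_, ?_⟩
    · rintro ⟨p, hp, k, hk, e1, e2, h1, h2, h3, h4⟩
      lift p to Fin n using hp
      lift k to Fin m using hk
      simp only [near1] at h1 h2 h3 h4
      exact ⟨p, fun h => e1 (by rw [h]), k, fun h => e2 (by rw [h]), h1, h2, h3, h4⟩
    · rintro ⟨p, e1, k, e2, h⟩
      simp only [← near1] at h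
      exact ⟨p, p.2, k, k.2, fun h => e1 (Fin.ext h), fun h => e2 (Fin.ext h), h⟩
  have owner3 : ∀ σ < m, s3.nat 12 σ 0 = σ % n := fun σ hσ =>
    assignOwners_run hn (by rw [k2 0 (by simp), k1 0 (by simp)]; exact h0)
      (by rw [k2 1 (by simp), k1 1 (by simp)]; exact h1)
      (by rw [k2 11 (by simp), k1 11 (by simp), hz 11 (by norm_num)]; rfl) hσ
  have adm : ∀ σ (hσ : σ < m) (j : Fin m), s3.Admissible j σ ↔
      Acceptable d ((T : ℝ) / n) ⟨σ % n, Nat.mod_lt _ hn⟩ j := fun σ hσ j => by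
    have e1 := small1 ⟨σ % n, Nat.mod_lt _ hn⟩ j
    have e2 := blocked2 ⟨σ % n, Nat.mod_lt _ hn⟩ j
    simp only at e1 e2
    rw [Memory.Admissible, owner3 σ hσ, r3, r2, k3 8 (by simp), k2 8 (by simp), k1 8 (by simp), h8,
      k3 10 (by simp), e1, e2, Acceptable]
  have e1 : s3.nat 1 0 0 = m := by
    rw [k3 1 (by simp), k2 1 (by simp), k1 1 (by simp)]; exact h1
  have hzero : ∀ z, 13 ≤ z → s3.nat z = 0 := fun z h13 => by
    rw [k3 z (by simp; omega), k2 z (by simp; omega), k1 z (by simp; omega), hz z (by omega)]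
  have hall' : HallCondition m s3.Admissible := by
    classical
    intro S hS N hN
    have h := hall (Finset.univ.filter fun j : Fin m => (j : ℕ) ∈ S)
      (Finset.univ.filter fun i : Fin n => ∃ j : Fin m, (j : ℕ) ∈ S ∧ Acceptable d ((T : ℝ) / n) i j)
      (fun i j hj hacc => by
        simp only [Finset.mem_filter, Finset.mem_univ, true_and] at hj ⊢
        exact ⟨j, hj, hacc⟩)
    rw [sum_slotCount] at h
    have hcard : S.card = (Finset.univ.filter fun j : Fin m => (j : ℕ) ∈ S).card := by
      rw [← Finset.card_map Fin.valEmbedding]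
      congr 1
      ext j
      simp only [Finset.mem_map, Finset.mem_filter, Finset.mem_univ, true_and, Fin.valEmbedding_apply]
      exact ⟨fun hj => ⟨⟨j, Finset.mem_range.1 (hS hj)⟩, hj, rfl⟩, by rintro ⟨j, hj, rfl⟩; exact hj⟩
    rw [hcard]
    refine h.trans (Finset.card_le_card fun σ hσ => ?_)
    simp only [Finset.mem_filter, Finset.mem_range] at hσ
    obtain ⟨hσ, i, hi', hi⟩ := hσ
    obtain ⟨j, hj, hacc⟩ := hi'.2
    refine hN σ hσ j hj ((adm σ hσ j).2 ?_)
    convert hacc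
  obtain ⟨fin, hcur⟩ := auction_run e1 (by rw [hzero 13 le_rfl]; rfl) (by rw [hzero 15 (by norm_num)]; simp)
    (by rw [hzero 16 (by norm_num)]; simp) hall'
  set s4 := auction.run s3 with hs4
  have k4 : ∀ z, z ∉ [3, 4, 5, 6, 13, 14, 15, 16, 17] → s4.nat z = s3.nat z := fun z hz => by
    simp only [List.mem_cons, List.not_mem_nil, or_false, not_or] at hz
    exact run_nat (by simp [auction, findSlot, takeSlot, swapBidder, KeepsNat, Cmd.cond, Cmd.assign, hz]) s3
  have e4 : s4.nat 1 0 0 = m := by rw [k4 1 (by simp)]; exact e1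
  have hex : ∀ j : Fin m, ∃ σ < m, s4.nat 16 σ 0 = j + 1 := fun j =>
    (fin.all j j.2).resolve_left (by omega)
  choose slot hslot hheld using hex
  have slot_inj : Function.Injective slot := fun j j' h => by
    have h1 := hheld j
    rw [h, hheld j'] at h1
    exact Fin.ext (by omega)
  refine ⟨fun j => ⟨slot j % n, Nat.mod_lt _ hn⟩, fun j => ?_, fun j => ?_, fun i => ?_⟩
  · rw [readSlots_run e4 fin.inj (hslot j) (hheld j), k4 12 (by simp), owner3 _ (hslot j)]
  · exact (adm _ (hslot j) j).1 (fin.adj _ (hslot j) _ (hheld j))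
  · have himage : Finset.univ.image slot = Finset.range m := by
      refine Finset.eq_of_subset_of_card_le (fun σ hσ => ?_) ?_
      · obtain ⟨j, -, rfl⟩ := Finset.mem_image.1 hσ
        exact Finset.mem_range.2 (hslot j)
      · rw [Finset.card_image_of_injective _ slot_inj]; simp
    rw [slotCount, ← himage, Finset.filter_image, Finset.card_image_of_injective _ slot_inj]
    simp only [Fin.ext_iff]

/-- The two ways in which `allocate` succeeds: with many chores if the disutilities do not produce
envy in the allocation to least disutilities, with few if Hall's condition holds. -/
theorem allocate_findsEnvyFree {C C' n m : ℕ} (hn : 1 ≤ n) (hm : 2 * n ≤ m)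
    {d : Fin n → Fin m → ℝ} (hd : ∀ i j, 0 ≤ d i j)
    (hmany : C' * n * (Nat.log 2 n + 1) ≤ m →
      ∀ i i', i ≠ i' → ∑ j, envyBound i i' (fun k => d k j) ≤ 0)
    (hfew : m < C' * n * (Nat.log 2 n + 1) →
      AgentHall d (((C * (Nat.log 2 n + 1) : ℕ) : ℝ) / n)) :
    FindsEnvyFree (allocate C C').toProgram n m d := by
  suffices h : ∃ owner : Fin m → Fin n,
      (∀ j : Fin m, ((allocate C C').run (inputMemory d)).nat 2 j 0 = owner j) ∧
      IsEnvyFree d fun i => Finset.univ.filter fun j => owner j = i by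
    obtain ⟨owner, h1, h2⟩ := h
    have h3 := outputBundles_eq h1
    exact findsEnvyFree_toProgram (allocate_wellFormed C C')
      (by rw [h3]; exact isAllocation_of_owner owner) (by rw [h3]; exact h2)
  obtain ⟨h8, h9⟩ := thresholds_run C C' hn (s := inputMemory d) (by simp [inputMemory])
    (by simp [inputMemory]) (by simp [inputMemory])
  rw [allocate, run]
  set s := (thresholds C C').run (inputMemory d) with hs
  have keep : ∀ z, z ∉ [3, 7, 8, 9] → s.nat z = (inputMemory d).nat z := fun z hz => by
    simp only [List.mem_cons, List.not_mem_nil, or_false, not_or] at hz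
    exact run_nat (by simp [thresholds, KeepsNat, Cmd.cond, Cmd.assign, hz]) _
  have hreal : s.real = (inputMemory d).real := by
    ext1 z; exact run_real (by simp [thresholds, KeepsReal, Cmd.cond, Cmd.assign]) _
  have h0 : s.nat 0 0 0 = n := by rw [keep 0 (by simp)]; simp [inputMemory]
  have h1 : s.nat 1 0 0 = m := by rw [keep 1 (by simp)]; simp [inputMemory]
  have hr : ∀ i : Fin n, ∀ j : Fin m, s.real 0 i j = d i j := fun i j => by
    rw [hreal]; simp [inputMemory]
  by_cases hc : C' * n * (Nat.log 2 n + 1) ≤ m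
  · rw [run, if_pos (by simpa [Test.Holds, h9, h1] using hc)]
    choose owner howner hown hle using fun j : Fin m => giveToLeast_run hn h0 h1 j.2
    refine ⟨fun j => ⟨owner j, howner j⟩, hown, isEnvyFree_of_least hd (fun j i => ?_) (hmany hc)⟩
    have h := hle j i i.2
    have h' := hr ⟨owner j, howner j⟩ j
    simp only at h'
    rwa [h', hr] at h
  · rw [run, if_neg (by simpa [Test.Holds, h9, h1] using hc)]
    obtain ⟨owner, e1, e2, e3⟩ := giveByMatching_run hn h0 h1 h8
      (fun z hz => by
        rw [keep z (by simp; omega)]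
        funext i j
        simp [inputMemory, show z ≠ 0 by omega, show z ≠ 1 by omega])
      hr (by rw [hreal]; funext i j; simp [inputMemory]) (hfew (not_le.1 hc))
    exact ⟨owner, e1, isEnvyFree_of_acceptable hn hm hd (by positivity) e2 e3⟩

/-! ### Bounded densities and independent draws -/

section Density

variable {α β : ℝ} {D : Measure ℝ}

theorem IsPDFBoundedBy.measureReal_le [IsProbabilityMeasure D] (h : IsPDFBoundedBy α β D)
    (hβ : 0 ≤ β) {X : Set ℝ} (hX : MeasurableSet X) {a b : ℝ} (hab : a ≤ b)
    (hsub : X ∩ Set.Icc 0 1 ⊆ Set.Icc a b) : D.real X ≤ β * (b - a) := by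
  obtain ⟨f, hf, hb, hD⟩ := h
  have key : D X ≤ ENNReal.ofReal (β * (b - a)) := by
    calc D X = ∫⁻ x in X ∩ Set.Icc 0 1, ENNReal.ofReal (f x) := by
          rw [hD, withDensity_apply _ hX, Measure.restrict_restrict hX]
      _ ≤ ∫⁻ x in X ∩ Set.Icc 0 1, ENNReal.ofReal β :=
          setLIntegral_mono measurable_const fun x hx => ENNReal.ofReal_le_ofReal (hb x hx.2).2
      _ = ENNReal.ofReal β * volume (X ∩ Set.Icc 0 1) := by simp
      _ ≤ ENNReal.ofReal β * volume (Set.Icc a b) := by gcongr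
      _ = ENNReal.ofReal (β * (b - a)) := by rw [Real.volume_Icc, ENNReal.ofReal_mul hβ]
  exact ENNReal.toReal_le_of_le_ofReal (mul_nonneg hβ (sub_nonneg.2 hab)) key

theorem IsPDFBoundedBy.le_measureReal [IsProbabilityMeasure D] (h : IsPDFBoundedBy α β D)
    (hα : 0 ≤ α) {X : Set ℝ} {a b : ℝ} (ha : 0 ≤ a) (hb1 : b ≤ 1)
    (hsub : Set.Icc a b ⊆ X) : α * (b - a) ≤ D.real X := by
  obtain ⟨f, hf, hb, hD⟩ := h
  refine le_trans ?_ (measureReal_mono (μ := D) hsub)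
  have hI : Set.Icc a b ⊆ Set.Icc (0 : ℝ) 1 := Set.Icc_subset_Icc ha hb1
  have key : ENNReal.ofReal (α * (b - a)) ≤ D (Set.Icc a b) := by
    calc ENNReal.ofReal (α * (b - a)) = ENNReal.ofReal α * volume (Set.Icc a b) := by
          rw [Real.volume_Icc, ENNReal.ofReal_mul hα]
      _ = ∫⁻ x in Set.Icc a b, ENNReal.ofReal α := by simp
      _ ≤ ∫⁻ x in Set.Icc a b, ENNReal.ofReal (f x) :=
          setLIntegral_mono (by fun_prop) fun x hx => ENNReal.ofReal_le_ofReal (hb x (hI hx)).1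
      _ = D (Set.Icc a b) := by
          rw [hD, withDensity_apply _ measurableSet_Icc, Measure.restrict_restrict measurableSet_Icc,
            Set.inter_eq_left.2 hI]
  exact (ENNReal.ofReal_le_iff_le_toReal (measure_ne_top _ _)).1 key

theorem IsPDFBoundedBy.ae_mem (h : IsPDFBoundedBy α β D) : ∀ᵐ x ∂D, x ∈ Set.Icc (0 : ℝ) 1 := by
  obtain ⟨f, hf, hb, hD⟩ := h
  rw [hD]
  exact (withDensity_absolutelyContinuous _ _).ae_le (ae_restrict_mem measurableSet_Icc)

theorem IsPDFBoundedBy.measureReal_Iic_le [IsProbabilityMeasure D] (h : IsPDFBoundedBy α β D)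
    (hβ : 0 ≤ β) {t : ℝ} (ht : 0 ≤ t) : D.real (Set.Iic t) ≤ β * t := by
  simpa using h.measureReal_le hβ measurableSet_Iic ht fun x hx => ⟨hx.2.1, hx.1⟩

theorem IsPDFBoundedBy.measureReal_Ioi_le [IsProbabilityMeasure D] (h : IsPDFBoundedBy α β D)
    (hα : 0 ≤ α) {t : ℝ} (ht1 : t ≤ 1) : D.real (Set.Ioi t) ≤ Real.exp (-(α * t)) := by
  have h1 : α * t ≤ D.real (Set.Iic t) := by
    simpa using h.le_measureReal hα le_rfl ht1 Set.Icc_subset_Iic_self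
  have h2 := measureReal_compl (μ := D) (s := Set.Iic t) measurableSet_Iic
  rw [Set.compl_Iic, probReal_univ] at h2
  have := Real.add_one_le_exp (-(α * t))
  linarith

theorem IsPDFBoundedBy.measureReal_Ici_le_Ioi [IsProbabilityMeasure D] (h : IsPDFBoundedBy α β D)
    (hβ : 0 ≤ β) (t : ℝ) : D.real (Set.Ici t) ≤ D.real (Set.Ioi t) := by
  have h0 : D.real {t} = 0 := by
    refine le_antisymm ?_ measureReal_nonneg
    simpa using h.measureReal_le hβ (measurableSet_singleton t) le_rfl
      (fun x hx => by rw [Set.Icc_self]; exact hx.1)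
  have h1 : D.real (Set.Ici t) ≤ D.real (Set.Ioi t) + D.real {t} := by
    rw [← Set.Ioi_union_left]; exact measureReal_union_le _ _
  linarith

theorem IsPDFBoundedBy.measureReal_Ici_le [IsProbabilityMeasure D] (h : IsPDFBoundedBy α β D)
    (hα : 0 ≤ α) (hβ : 0 ≤ β) {t : ℝ} (ht1 : t ≤ 1) :
    D.real (Set.Ici t) ≤ Real.exp (-(α * t)) :=
  (h.measureReal_Ici_le_Ioi hβ t).trans (h.measureReal_Ioi_le hα ht1)

end Density

variable {D : Measure ℝ} [IsProbabilityMeasure D] {n m : ℕ}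

instance : IsProbabilityMeasure (disutilityLaw D n m) := by
  unfold disutilityLaw; infer_instance

theorem disutilityLaw_entries (E : Finset (Fin n × Fin m)) (X : Set ℝ) :
    (disutilityLaw D n m).real {d | ∀ e ∈ E, d e.1 e.2 ∈ X} = D.real X ^ E.card := by
  have hset : {d : Fin n → Fin m → ℝ | ∀ e ∈ E, d e.1 e.2 ∈ X} =
      Set.univ.pi fun i => Set.univ.pi fun j => if (i, j) ∈ E then X else Set.univ := by
    ext d
    simp only [Set.mem_ofPred_eq, Set.mem_univ_pi, Prod.forall]
    refine forall₂_congr fun i j => ?_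
    split_ifs with h <;> simp [h]
  rw [hset, disutilityLaw, Measure.real, Measure.pi_pi]
  simp only [Measure.pi_pi]
  rw [← Finset.prod_product', Finset.univ_product_univ]
  have : ∀ x : Fin n × Fin m, D (if (x.1, x.2) ∈ E then X else Set.univ) =
      if x ∈ E then D X else 1 := fun x => by split_ifs <;> simp
  simp only [this, Finset.prod_ite_mem, Finset.univ_inter, Finset.prod_const, ENNReal.toReal_pow,
    Measure.real]

theorem disutilityLaw_ae_nonneg {α β : ℝ} (h : IsPDFBoundedBy α β D) :
    ∀ᵐ d ∂disutilityLaw D n m, ∀ i j, 0 ≤ d i j := by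
  have h1 : ∀ᵐ x ∂(Measure.pi fun _ : Fin m => D), ∀ j, x j ∈ Set.Icc (0 : ℝ) 1 :=
    ae_all_iff.2 fun j => (Measure.tendsto_eval_ae_ae (i := j)).eventually h.ae_mem
  refine ae_all_iff.2 fun i => ?_
  filter_upwards [(Measure.tendsto_eval_ae_ae (μ := fun _ : Fin n =>
    Measure.pi fun _ : Fin m => D) (i := i)).eventually h1] with d hd j using (hd j).1

/-- The union bound for events that each require many entries to lie in a set. -/
theorem disutilityLaw_union_le {ι : Type*} (F : Finset ι) (E : ι → Finset (Fin n × Fin m))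
    (X : Set ℝ) {k : ℕ} (hE : ∀ x ∈ F, k ≤ (E x).card) :
    (disutilityLaw D n m).real {d | ∃ x ∈ F, ∀ e ∈ E x, d e.1 e.2 ∈ X} ≤ F.card * D.real X ^ k := by
  have hset : {d : Fin n → Fin m → ℝ | ∃ x ∈ F, ∀ e ∈ E x, d e.1 e.2 ∈ X} =
      ⋃ x ∈ F, {d | ∀ e ∈ E x, d e.1 e.2 ∈ X} := by ext; simp
  rw [hset]
  refine (measureReal_biUnion_finset_le _ _).trans ?_
  rw [← nsmul_eq_mul]
  refine Finset.sum_le_card_nsmul _ _ _ fun x hx => ?_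
  rw [disutilityLaw_entries]
  exact pow_le_pow_of_le_one measureReal_nonneg measureReal_le_one (hE x hx)

/-! ### Rectangles of small disutilities -/

/-- Some `a` agents and `b` chores, with `a, b ≤ 4`, span at least `a + b + 1` pairs of disutility at
most `t`. -/
def HasDenseSpot (d : Fin n → Fin m → ℝ) (t : ℝ) : Prop :=
  ∃ (A : Finset (Fin n)) (J : Finset (Fin m)) (E : Finset (Fin n × Fin m)), A.card ≤ 4 ∧ J.card ≤ 4 ∧
    E ⊆ A ×ˢ J ∧ A.card + J.card + 1 ≤ E.card ∧ ∀ e ∈ E, d e.1 e.2 ≤ t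

theorem disutilityLaw_hasDenseSpot_le {t x y : ℝ} (hn : 1 ≤ n) (hx : 1 ≤ x) (hy : 1 ≤ y)
    (ht : D.real (Set.Iic t) ≤ x / n) (hm : (m : ℝ) ≤ y * n) :
    (disutilityLaw D n m).real {d | HasDenseSpot d t} ≤ 25 * 2 ^ 16 * (x ^ 9 * y ^ 4) / n := by
  have hn' : (0 : ℝ) < n := by exact_mod_cast hn
  let F : ℕ × ℕ → Finset (Finset (Fin n) × Finset (Fin m) × Finset (Fin n × Fin m)) := fun c =>
    (Finset.univ.powersetCard c.1).biUnion fun A =>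
      (Finset.univ.powersetCard c.2).biUnion fun J =>
        ((A ×ˢ J).powerset.filter fun E => c.1 + c.2 + 1 ≤ E.card).image fun E => (A, J, E)
  have hset : {d : Fin n → Fin m → ℝ | HasDenseSpot d t} ⊆
      ⋃ c ∈ Finset.range 5 ×ˢ Finset.range 5,
        {d | ∃ x ∈ F c, ∀ e ∈ x.2.2, d e.1 e.2 ∈ Set.Iic t} := by
    rintro d ⟨A, J, E, hA, hJ, hE, hcard, hd⟩
    simp only [Set.mem_iUnion]
    refine ⟨(A.card, J.card), by simp; omega, (A, J, E), ?_, hd⟩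
    simp only [F, Finset.mem_biUnion, Finset.mem_powersetCard, Finset.mem_image, Finset.mem_filter,
      Finset.mem_powerset]
    exact ⟨A, ⟨Finset.subset_univ _, rfl⟩, J, ⟨Finset.subset_univ _, rfl⟩, E, ⟨hE, hcard⟩, rfl⟩
  have hF : ∀ c ∈ Finset.range 5 ×ˢ Finset.range 5, (F c).card ≤ n ^ c.1 * (m ^ c.2 * 2 ^ 16) := by
    rintro ⟨a, b⟩ hc
    simp only [Finset.mem_product, Finset.mem_range] at hc
    refine (Finset.card_biUnion_le_card_mul _ _ (m ^ b * 2 ^ 16) fun A hA => ?_).trans ?_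
    · refine (Finset.card_biUnion_le_card_mul _ _ (2 ^ 16) fun J hJ => ?_).trans ?_
      · refine Finset.card_image_le.trans ((Finset.card_filter_le _ _).trans ?_)
        rw [Finset.card_powerset, Finset.card_product, (Finset.mem_powersetCard.1 hA).2,
          (Finset.mem_powersetCard.1 hJ).2]
        refine Nat.pow_le_pow_right (by norm_num) ?_
        calc a * b ≤ 4 * 4 := Nat.mul_le_mul (by omega) (by omega)
          _ = 16 := rfl
      · gcongr
        rw [Finset.card_powersetCard, Finset.card_univ, Fintype.card_fin]
        exact Nat.choose_le_pow _ _
    · gcongr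
      rw [Finset.card_powersetCard, Finset.card_univ, Fintype.card_fin]
      exact Nat.choose_le_pow _ _
  refine (measureReal_mono hset (measure_ne_top _ _)).trans ((measureReal_biUnion_finset_le _ _).trans ?_)
  have hterm : ∀ c ∈ Finset.range 5 ×ˢ Finset.range 5,
      (disutilityLaw D n m).real {d | ∃ x ∈ F c, ∀ e ∈ x.2.2, d e.1 e.2 ∈ Set.Iic t} ≤
        2 ^ 16 * (x ^ 9 * y ^ 4) / n := by
    intro c hc
    refine (disutilityLaw_union_le (F c) (fun x => x.2.2) _ (k := c.1 + c.2 + 1) ?_).trans ?_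
    · intro z hz
      simp only [F, Finset.mem_biUnion, Finset.mem_image, Finset.mem_filter] at hz
      obtain ⟨A, -, J, -, E, ⟨-, hE⟩, rfl⟩ := hz
      exact hE
    · have h1 : ((F c).card : ℝ) ≤ n ^ c.1 * ((y * n) ^ c.2 * 2 ^ 16) := by
        calc ((F c).card : ℝ) ≤ n ^ c.1 * (m ^ c.2 * 2 ^ 16) := by exact_mod_cast hF c hc
          _ ≤ _ := by gcongr
      simp only [Finset.mem_product, Finset.mem_range] at hc
      calc ((F c).card : ℝ) * D.real (Set.Iic t) ^ (c.1 + c.2 + 1)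
          ≤ n ^ c.1 * ((y * n) ^ c.2 * 2 ^ 16) * (x / n) ^ (c.1 + c.2 + 1) := by gcongr
        _ = 2 ^ 16 * (x ^ (c.1 + c.2 + 1) * y ^ c.2) / n := by
            rw [div_pow, mul_pow, pow_succ (n : ℝ), pow_add (n : ℝ)]
            field_simp
        _ ≤ 2 ^ 16 * (x ^ 9 * y ^ 4) / n := by
            gcongr
            · omega
            · omega
  refine (Finset.sum_le_card_nsmul _ _ _ hterm).trans ?_
  rw [Finset.card_product, Finset.card_range, nsmul_eq_mul]
  exact le_of_eq (by push_cast; ring)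

/-- If two distinct rectangles of small disutilities share an agent or a chore, their union is a dense
spot: with `x` common agents and `y` common chores, it has `8 - x - y` vertices and `8 - x * y`
pairs. -/
theorem rectangle_unique {d : Fin n → Fin m → ℝ} {t : ℝ} (hd : ¬ HasDenseSpot d t)
    {A₁ A₂ : Finset (Fin n)} {J₁ J₂ : Finset (Fin m)} (hA₁ : A₁.card = 2) (hA₂ : A₂.card = 2)
    (hJ₁ : J₁.card = 2) (hJ₂ : J₂.card = 2) (h₁ : ∀ e ∈ A₁ ×ˢ J₁, d e.1 e.2 ≤ t)
    (h₂ : ∀ e ∈ A₂ ×ˢ J₂, d e.1 e.2 ≤ t) (hmeet : (A₁ ∩ A₂).Nonempty ∨ (J₁ ∩ J₂).Nonempty) :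
    A₁ = A₂ ∧ J₁ = J₂ := by
  have hA := Finset.card_union_add_card_inter A₁ A₂
  have hJ := Finset.card_union_add_card_inter J₁ J₂
  have hE := Finset.card_union_add_card_inter (A₁ ×ˢ J₁) (A₂ ×ˢ J₂)
  rw [Finset.product_inter_product, Finset.card_product, Finset.card_product, Finset.card_product]
    at hE
  have hx : (A₁ ∩ A₂).card ≤ 2 := hA₁ ▸ Finset.card_le_card Finset.inter_subset_left
  have hy : (J₁ ∩ J₂).card ≤ 2 := hJ₁ ▸ Finset.card_le_card Finset.inter_subset_left
  rw [← Finset.card_pos, ← Finset.card_pos] at hmeet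
  have hboth : (A₁ ∩ A₂).card = 2 ∧ (J₁ ∩ J₂).card = 2 := by
    by_contra hne
    refine hd ⟨A₁ ∪ A₂, J₁ ∪ J₂, (A₁ ×ˢ J₁) ∪ (A₂ ×ˢ J₂), by omega, by omega, ?_, ?_, ?_⟩
    · exact Finset.union_subset
        (Finset.product_subset_product Finset.subset_union_left Finset.subset_union_left)
        (Finset.product_subset_product Finset.subset_union_right Finset.subset_union_right)
    · rw [hA₁, hA₂, hJ₁, hJ₂] at *
      generalize (A₁ ∩ A₂).card = x at *
      generalize (J₁ ∩ J₂).card = y at *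
      interval_cases x <;> interval_cases y <;> omega
    · intro e he
      rcases Finset.mem_union.1 he with he | he
      · exact h₁ e he
      · exact h₂ e he
  constructor
  · rw [← Finset.eq_of_subset_of_card_le (Finset.inter_subset_left (s₁ := A₁) (s₂ := A₂)) (by omega)]
    exact Finset.eq_of_subset_of_card_le Finset.inter_subset_right (by omega)
  · rw [← Finset.eq_of_subset_of_card_le (Finset.inter_subset_left (s₁ := J₁) (s₂ := J₂)) (by omega)]
    exact Finset.eq_of_subset_of_card_le Finset.inter_subset_right (by omega)

theorem Blocked.exists_rectangle {d : Fin n → Fin m → ℝ} {t : ℝ} {i : Fin n} {j : Fin m}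
    (h : Blocked d t i j) : ∃ (A : Finset (Fin n)) (J : Finset (Fin m)), A.card = 2 ∧ J.card = 2 ∧
      i ∈ A ∧ j ∈ J ∧ ∀ e ∈ A ×ˢ J, d e.1 e.2 ≤ t := by
  obtain ⟨p, hp, k, hk, h1, h2, h3, h4⟩ := h
  refine ⟨{i, p}, {j, k}, Finset.card_pair hp, Finset.card_pair hk, by simp, by simp, ?_⟩
  rintro ⟨a, b⟩ he
  simp only [Finset.mem_product, Finset.mem_insert, Finset.mem_singleton] at he
  rcases he with ⟨rfl | rfl, rfl | rfl⟩ <;> assumption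

open Classical in
theorem card_blocked_agents_le {d : Fin n → Fin m → ℝ} {t : ℝ} (hd : ¬ HasDenseSpot d t)
    (j : Fin m) : (Finset.univ.filter fun i => Blocked d t i j).card ≤ 2 := by
  rcases Finset.eq_empty_or_nonempty (Finset.univ.filter fun i => Blocked d t i j) with h | ⟨i, hi⟩
  · simp [h]
  · obtain ⟨A, J, hA, hJ, -, hj, hAJ⟩ := (Finset.mem_filter.1 hi).2.exists_rectangle
    rw [← hA]
    refine Finset.card_le_card fun i' hi' => ?_
    obtain ⟨A', J', hA', hJ', hi', hj', hAJ'⟩ := (Finset.mem_filter.1 hi').2.exists_rectangle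
    rw [(rectangle_unique hd hA hA' hJ hJ' hAJ hAJ' (.inr ⟨j, Finset.mem_inter.2 ⟨hj, hj'⟩⟩)).1]
    exact hi'

open Classical in
theorem card_blocked_chores_le {d : Fin n → Fin m → ℝ} {t : ℝ} (hd : ¬ HasDenseSpot d t)
    (i : Fin n) : (Finset.univ.filter fun j => Blocked d t i j).card ≤ 2 := by
  rcases Finset.eq_empty_or_nonempty (Finset.univ.filter fun j => Blocked d t i j) with h | ⟨j, hj⟩
  · simp [h]
  · obtain ⟨A, J, hA, hJ, hi, -, hAJ⟩ := (Finset.mem_filter.1 hj).2.exists_rectangle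
    rw [← hJ]
    refine Finset.card_le_card fun j' hj' => ?_
    obtain ⟨A', J', hA', hJ', hi', hj', hAJ'⟩ := (Finset.mem_filter.1 hj').2.exists_rectangle
    rw [(rectangle_unique hd hA hA' hJ hJ' hAJ hAJ' (.inl ⟨i, Finset.mem_inter.2 ⟨hi, hi'⟩⟩)).2]
    exact hj'

/-! ### Hall's condition holds with high probability -/

/-- Finite sets with at most `k` elements are ranges of maps from `Fin k`, up to a default value. -/
theorem card_smallFinsets_le {ι : Type*} [Fintype ι] [DecidableEq ι] (k : ℕ) :
    (Finset.univ.filter fun S : Finset ι => S.card ≤ k).card ≤ (Fintype.card ι + 1) ^ k := by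
  have hcard : (Finset.univ : Finset (Fin k → Option ι)).card = (Fintype.card ι + 1) ^ k := by simp
  rw [← hcard]
  refine (Finset.card_le_card fun S hS => ?_).trans
    (Finset.card_image_le (s := Finset.univ) (f := fun g : Fin k → Option ι =>
      Finset.univ.filter fun i => ∃ r, g r = some i))
  have hS := (Finset.mem_filter.1 hS).2
  let e := S.equivFin
  refine Finset.mem_image.2 ⟨fun r => if h : (r : ℕ) < S.card then some (e.symm ⟨r, h⟩).1 else none,
    Finset.mem_univ _, ?_⟩
  ext i
  simp only [Finset.mem_filter, Finset.mem_univ, true_and]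
  constructor
  · rintro ⟨r, hr⟩
    split_ifs at hr with h
    have := (e.symm ⟨r, h⟩).2
    rw [Option.some.injEq] at hr
    rwa [hr] at this
  · intro hi
    refine ⟨⟨e ⟨i, hi⟩, (e ⟨i, hi⟩).2.trans_le hS⟩, ?_⟩
    simp

/-- The triples of a set of agents, a set of chores and a set of pairs of bounded sizes. -/
def smallTriples (n m a b c : ℕ) :
    Finset (Finset (Fin n) × Finset (Fin m) × Finset (Fin n × Fin m)) :=
  (Finset.univ.filter fun T => T.card ≤ a) ×ˢ (Finset.univ.filter fun S => S.card ≤ b) ×ˢ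
    (Finset.univ.filter fun E => E.card ≤ c)

theorem card_smallTriples_le (a b c : ℕ) {L : ℕ} (hn : n < 2 ^ L) (hm : m < 2 ^ (2 * L)) :
    (smallTriples n m a b c).card ≤ 2 ^ (L * (a + 2 * b + 3 * c)) := by
  rw [smallTriples, Finset.card_product, Finset.card_product]
  have hnm : n * m < 2 ^ (3 * L) := by
    rw [show 3 * L = L + 2 * L by ring, pow_add]
    exact Nat.mul_lt_mul'' hn hm
  calc _ ≤ (n + 1) ^ a * ((m + 1) ^ b * (n * m + 1) ^ c) := by
        refine Nat.mul_le_mul ?_ (Nat.mul_le_mul ?_ ?_)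
        · simpa using card_smallFinsets_le (ι := Fin n) a
        · simpa using card_smallFinsets_le (ι := Fin m) b
        · simpa using card_smallFinsets_le (ι := Fin n × Fin m) c
    _ ≤ (2 ^ L) ^ a * ((2 ^ (2 * L)) ^ b * (2 ^ (3 * L)) ^ c) := by
        gcongr <;> omega
    _ = 2 ^ (L * (a + 2 * b + 3 * c)) := by
        rw [← pow_mul, ← pow_mul, ← pow_mul, ← pow_add, ← pow_add]; congr 1; ring

/-- If each vertex lies in few blocked pairs, a violation of Hall's condition produces few chores `S`
and many agents outside a set `N`, or few agents `T` and many chores outside a set `S`, all of whose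
pairs are of disutility more than `τ`, up to few exceptions. -/
theorem exists_of_not_agentHall {d : Fin n → Fin m → ℝ} {τ : ℝ} (hn : 1 ≤ n) (hm : 2 * n ≤ m)
    (hd : ¬ HasDenseSpot d (3 * τ)) (hall : ¬ AgentHall d τ) :
    (∃ s, 1 ≤ s ∧ s ≤ m ∧ ∃ x ∈ smallTriples n m s s (2 * s),
      x.2.1.card = s ∧ n < 3 * x.1ᶜ.card ∧
        ∀ e ∈ (x.1ᶜ ×ˢ x.2.1) \ x.2.2, d e.1 e.2 ∈ Set.Ioi τ) ∨
    (∃ t, 1 ≤ t ∧ t ≤ n ∧ ∃ x ∈ smallTriples n m t ((m / n + 1) * t) (2 * t),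
      x.1.card = t ∧ m < 2 * x.2.1ᶜ.card ∧
        ∀ e ∈ (x.1 ×ˢ x.2.1ᶜ) \ x.2.2, d e.1 e.2 ∈ Set.Ioi τ) := by
  classical
  rw [AgentHall] at hall
  push Not at hall
  obtain ⟨S, N, hN, hlt⟩ := hall
  set q := m / n with hq
  have hq2 : 2 ≤ q := (Nat.le_div_iff_mul_le hn).2 hm
  have hqn : q * n ≤ m := Nat.div_mul_le_self m n
  let E := (Nᶜ ×ˢ S).filter fun e => Blocked d (3 * τ) e.1 e.2
  have hE1 : E.card ≤ 2 * S.card := by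
    have h := Finset.card_le_mul_card_image_of_maps_to (s := E) (t := S) (f := Prod.snd)
      (fun e he => (Finset.mem_product.1 (Finset.mem_filter.1 he).1).2) 2 (fun j _ => by
        refine le_trans ?_ (card_blocked_agents_le hd j)
        refine Finset.card_le_card_of_injOn Prod.fst (fun e he => ?_) ?_
        · simp only [E, Finset.coe_filter, Finset.mem_filter, Set.mem_ofPred_eq] at he
          simp [← he.2, he.1.2]
        · rintro ⟨a, b⟩ h1 ⟨a', b'⟩ h2 h3
          simp only [Finset.coe_filter, Set.mem_ofPred_eq] at h1 h2 h3
          rw [h3, h1.2, h2.2])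
    exact h
  have hE2 : E.card ≤ 2 * Nᶜ.card := by
    have h := Finset.card_le_mul_card_image_of_maps_to (s := E) (t := Nᶜ) (f := Prod.fst)
      (fun e he => (Finset.mem_product.1 (Finset.mem_filter.1 he).1).1) 2 (fun i _ => by
        refine le_trans ?_ (card_blocked_chores_le hd i)
        refine Finset.card_le_card_of_injOn Prod.snd (fun e he => ?_) ?_
        · simp only [E, Finset.coe_filter, Finset.mem_filter, Set.mem_ofPred_eq] at he
          simp [← he.2, he.1.2]
        · rintro ⟨a, b⟩ h1 ⟨a', b'⟩ h2 h3
          simp only [Finset.coe_filter, Set.mem_ofPred_eq] at h1 h2 h3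
          rw [h3, h1.2, h2.2])
    exact h
  have hgap : ∀ e ∈ (Nᶜ ×ˢ S) \ E, d e.1 e.2 ∈ Set.Ioi τ := by
    intro e he
    obtain ⟨he, hnE⟩ := Finset.mem_sdiff.1 he
    have hb : ¬ Blocked d (3 * τ) e.1 e.2 := fun h => hnE (Finset.mem_filter.2 ⟨he, h⟩)
    obtain ⟨h1, h2⟩ := Finset.mem_product.1 he
    by_contra hle
    exact Finset.mem_compl.1 h1 (hN _ _ h2 ⟨not_lt.1 hle, hb⟩)
  have hsum := Finset.sum_add_sum_compl N fun i : Fin n => slotCount m n i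
  rw [sum_slotCount_univ hn] at hsum
  have hNle : N.card * q ≤ ∑ i ∈ N, slotCount m n i := by
    rw [← smul_eq_mul]
    exact Finset.card_nsmul_le_sum _ _ _ fun i _ => le_slotCount i.2
  have hTle : ∑ i ∈ Nᶜ, slotCount m n i ≤ Nᶜ.card * (q + 1) := by
    rw [← smul_eq_mul]
    exact Finset.sum_le_card_nsmul _ _ _ fun i _ => slotCount_le i.2
  have hSm : S.card ≤ m := by simpa using Finset.card_le_univ S
  have hTn : Nᶜ.card ≤ n := by simpa using Finset.card_le_univ Nᶜ
  have hS' : Sᶜ.card = m - S.card := by rw [Finset.card_compl, Fintype.card_fin]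
  rcases le_or_gt (2 * S.card) m with hcase | hcase
  · refine .inl ⟨S.card, by omega, hSm, (N, S, E), ?_, rfl, ?_, hgap⟩
    · simp only [smallTriples, Finset.mem_product, Finset.mem_filter, Finset.mem_univ, true_and]
      refine ⟨?_, le_rfl, hE1⟩
      nlinarith
    · change n < 3 * Nᶜ.card
      by_contra! hle
      nlinarith
  · refine .inr ⟨Nᶜ.card, ?_, hTn, (Nᶜ, Sᶜ, E), ?_, rfl, ?_, ?_⟩
    · by_contra! h0
      have : Nᶜ.card = 0 := by omega
      rw [this] at hTle
      omega
    · simp only [smallTriples, Finset.mem_product, Finset.mem_filter, Finset.mem_univ, true_and]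
      refine ⟨le_rfl, ?_, hE2⟩
      rw [mul_comm]; omega
    · simpa using hcase
    · simpa using hgap

theorem exp_neg_natCast_le (k : ℕ) : Real.exp (-(k : ℝ)) ≤ ((2 : ℝ) ^ k)⁻¹ := by
  rw [Real.exp_neg]
  refine inv_anti₀ (by positivity) ?_
  have h2 : (2 : ℝ) ≤ Real.exp 1 := by have := Real.add_one_le_exp (1 : ℝ); linarith
  calc (2 : ℝ) ^ k ≤ Real.exp 1 ^ k := by gcongr
    _ = Real.exp k := by rw [← Real.exp_nat_mul, mul_one]

/-- A union bound over `2 ^ u` events, each requiring `k` disutilities to be large. -/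
theorem disutilityLaw_gap_le {ι : Type*} {F : Finset ι} {E : ι → Finset (Fin n × Fin m)} {τ p : ℝ}
    {k u v : ℕ} (hD : D.real (Set.Ioi τ) ≤ Real.exp (-p)) (hF : F.card ≤ 2 ^ u)
    (hE : ∀ x ∈ F, k ≤ (E x).card) (hkp : ((u + v : ℕ) : ℝ) ≤ k * p) :
    (disutilityLaw D n m).real {d | ∃ x ∈ F, ∀ e ∈ E x, d e.1 e.2 ∈ Set.Ioi τ} ≤ ((2 : ℝ) ^ v)⁻¹ := by
  refine (disutilityLaw_union_le F E _ hE).trans ?_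
  calc (F.card : ℝ) * D.real (Set.Ioi τ) ^ k ≤ 2 ^ u * Real.exp (-p) ^ k := by
        gcongr
        exact_mod_cast hF
    _ = 2 ^ u * Real.exp (-(k * p)) := by rw [← Real.exp_nat_mul]; congr 2; ring
    _ ≤ 2 ^ u * Real.exp (-((u + v : ℕ) : ℝ)) := by gcongr
    _ ≤ 2 ^ u * ((2 : ℝ) ^ (u + v))⁻¹ := by gcongr; exact exp_neg_natCast_le _
    _ = ((2 : ℝ) ^ v)⁻¹ := by rw [pow_add]; field_simp

/-- With threshold `τ = T / n`, where `T` is a large multiple of `L`, Hall's condition fails with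
probability `O(1 / n)` on the event that there is no dense spot. -/
theorem disutilityLaw_not_agentHall_le {α τ : ℝ} {L : ℕ} (hn : 12 ≤ n) (hm : 2 * n ≤ m)
    (hL : 1 ≤ L) (hnL : n < 2 ^ L) (hmn : m < n * n)
    (hτ : 144 * (L : ℝ) ≤ α * τ * n) (hD : D.real (Set.Ioi τ) ≤ Real.exp (-(α * τ))) :
    (disutilityLaw D n m).real {d | ¬ HasDenseSpot d (3 * τ) ∧ ¬ AgentHall d τ} ≤ 2 / n := by
  classical
  have hn0 : (0 : ℝ) < n := by exact_mod_cast (by omega : 0 < n)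
  have hmL : m < 2 ^ (2 * L) := by
    rw [two_mul, pow_add]; exact hmn.trans (Nat.mul_lt_mul'' hnL hnL)
  set q := m / n with hq
  have hq2 : 2 ≤ q := (Nat.le_div_iff_mul_le (by omega)).2 hm
  have hqn : q * n ≤ m := Nat.div_mul_le_self m n
  set μ := disutilityLaw D n m with hμ
  let A : ℕ → Set (Fin n → Fin m → ℝ) := fun s =>
    {d | ∃ x ∈ (smallTriples n m s s (2 * s)).filter fun x => x.2.1.card = s ∧ n < 3 * x.1ᶜ.card,
      ∀ e ∈ (x.1ᶜ ×ˢ x.2.1) \ x.2.2, d e.1 e.2 ∈ Set.Ioi τ}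
  let B : ℕ → Set (Fin n → Fin m → ℝ) := fun t =>
    {d | ∃ x ∈ (smallTriples n m t ((q + 1) * t) (2 * t)).filter fun x =>
      x.1.card = t ∧ m < 2 * x.2.1ᶜ.card,
      ∀ e ∈ (x.1 ×ˢ x.2.1ᶜ) \ x.2.2, d e.1 e.2 ∈ Set.Ioi τ}
  have hsub : {d : Fin n → Fin m → ℝ | ¬ HasDenseSpot d (3 * τ) ∧ ¬ AgentHall d τ} ⊆
      (⋃ s ∈ Finset.Icc 1 m, A s) ∪ ⋃ t ∈ Finset.Icc 1 n, B t := by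
    rintro d ⟨hd, hall⟩
    rcases exists_of_not_agentHall (by omega) hm hd hall with
      ⟨s, h1, h2, x, hx, h3, h4, h5⟩ | ⟨s, h1, h2, x, hx, h3, h4, h5⟩
    · refine .inl (Set.mem_iUnion₂.2 ⟨s, Finset.mem_Icc.2 ⟨h1, h2⟩, x, ?_, h5⟩)
      exact Finset.mem_filter.2 ⟨hx, h3, h4⟩
    · refine .inr (Set.mem_iUnion₂.2 ⟨s, Finset.mem_Icc.2 ⟨h1, h2⟩, x, ?_, h5⟩)
      exact Finset.mem_filter.2 ⟨hx, h3, h4⟩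
  -- `2 ^ (9 * L * s)` triples, each of probability at most `exp (-12 * L * s)`, as at least
  -- `s * (n / 3 - 2) ≥ s * n / 12` disutilities exceed `τ`
  have hA : ∀ s ∈ Finset.Icc 1 m, μ.real (A s) ≤ ((2 : ℝ) ^ (3 * L))⁻¹ := by
    intro s hs
    have hs1 := (Finset.mem_Icc.1 hs).1
    refine disutilityLaw_gap_le (k := s * (n / 3 - 2)) (u := L * (s + 2 * s + 3 * (2 * s))) hD
      ((Finset.card_filter_le _ _).trans (card_smallTriples_le _ _ _ hnL hmL)) (fun x hx => ?_) ?_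
    · simp only [smallTriples, Finset.mem_filter, Finset.mem_product, Finset.mem_univ, true_and] at hx
      obtain ⟨⟨-, -, h1⟩, h2, h3⟩ := hx
      have h4 := Finset.le_card_sdiff x.2.2 (x.1ᶜ ×ˢ x.2.1)
      rw [Finset.card_product, h2] at h4
      refine le_trans ?_ h4
      have : s * (n / 3) ≤ x.1ᶜ.card * s := by
        rw [mul_comm]; exact Nat.mul_le_mul_right _ (by omega)
      rw [Nat.mul_sub]
      omega
    · have h6 : (n : ℝ) ≤ 12 * ((n / 3 - 2 : ℕ) : ℝ) := by
        exact_mod_cast (by omega : n ≤ 12 * (n / 3 - 2))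
      have h7 : 12 * (L : ℝ) ≤ ((n / 3 - 2 : ℕ) : ℝ) * (α * τ) := by nlinarith
      have h8 : L * (s + 2 * s + 3 * (2 * s)) + 3 * L ≤ s * (12 * L) := by nlinarith
      calc ((L * (s + 2 * s + 3 * (2 * s)) + 3 * L : ℕ) : ℝ) ≤ s * (12 * L) := by exact_mod_cast h8
        _ ≤ s * (((n / 3 - 2 : ℕ) : ℝ) * (α * τ)) := by gcongr
        _ = _ := by push_cast; ring
  -- `2 ^ (L * t * (2 * q + 9))` triples, each of probability at most `exp (-36 * q * L * t)`, as at
  -- least `t * (q * n / 2 - 2) ≥ t * q * n / 4` disutilities exceed `τ`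
  have hB : ∀ t ∈ Finset.Icc 1 n, μ.real (B t) ≤ ((2 : ℝ) ^ (3 * L))⁻¹ := by
    intro t ht
    have ht1 := (Finset.mem_Icc.1 ht).1
    refine disutilityLaw_gap_le (k := t * (q * n / 2 - 2))
      (u := L * (t + 2 * ((q + 1) * t) + 3 * (2 * t))) hD
      ((Finset.card_filter_le _ _).trans (card_smallTriples_le _ _ _ hnL hmL)) (fun x hx => ?_) ?_
    · simp only [smallTriples, Finset.mem_filter, Finset.mem_product, Finset.mem_univ, true_and] at hx
      obtain ⟨⟨-, -, h1⟩, h2, h3⟩ := hx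
      have h4 := Finset.le_card_sdiff x.2.2 (x.1 ×ˢ x.2.1ᶜ)
      rw [Finset.card_product, h2] at h4
      refine le_trans ?_ h4
      have : t * (q * n / 2) ≤ t * x.2.1ᶜ.card := Nat.mul_le_mul_left _ (by omega)
      rw [Nat.mul_sub]
      omega
    · have h6 : ((q * n : ℕ) : ℝ) ≤ 4 * ((q * n / 2 - 2 : ℕ) : ℝ) := by
        have : 24 ≤ q * n := by nlinarith
        exact_mod_cast (by omega : q * n ≤ 4 * (q * n / 2 - 2))
      rw [Nat.cast_mul] at h6
      have h7 : 36 * (q * (L : ℝ)) ≤ ((q * n / 2 - 2 : ℕ) : ℝ) * (α * τ) := by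
        have h8 : (q : ℝ) * (144 * L) ≤ q * (α * τ * n) := by gcongr
        nlinarith
      have h8 : L * (t + 2 * ((q + 1) * t) + 3 * (2 * t)) + 3 * L ≤ t * (36 * (q * L)) := by
        have e1 : L ≤ L * t := Nat.le_mul_of_pos_right _ ht1
        have e2 : L * t * 2 ≤ L * t * q := Nat.mul_le_mul_left _ hq2
        nlinarith
      calc ((L * (t + 2 * ((q + 1) * t) + 3 * (2 * t)) + 3 * L : ℕ) : ℝ)
          ≤ t * (36 * (q * L)) := by exact_mod_cast h8
        _ ≤ t * (((q * n / 2 - 2 : ℕ) : ℝ) * (α * τ)) := by gcongr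
        _ = _ := by push_cast; ring
  have hpow : ((2 : ℝ) ^ (3 * L))⁻¹ ≤ 1 / (n : ℝ) ^ 3 := by
    rw [one_div]
    refine inv_anti₀ (by positivity) ?_
    rw [mul_comm, pow_mul]
    gcongr
    exact_mod_cast hnL.le
  calc μ.real {d | ¬ HasDenseSpot d (3 * τ) ∧ ¬ AgentHall d τ}
      ≤ μ.real ((⋃ s ∈ Finset.Icc 1 m, A s) ∪ ⋃ t ∈ Finset.Icc 1 n, B t) :=
        measureReal_mono hsub (measure_ne_top _ _)
    _ ≤ μ.real (⋃ s ∈ Finset.Icc 1 m, A s) + μ.real (⋃ t ∈ Finset.Icc 1 n, B t) :=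
        measureReal_union_le _ _
    _ ≤ (Finset.Icc 1 m).card • ((2 : ℝ) ^ (3 * L))⁻¹ +
          (Finset.Icc 1 n).card • ((2 : ℝ) ^ (3 * L))⁻¹ := by
        gcongr
        · exact (measureReal_biUnion_finset_le _ _).trans (Finset.sum_le_card_nsmul _ _ _ hA)
        · exact (measureReal_biUnion_finset_le _ _).trans (Finset.sum_le_card_nsmul _ _ _ hB)
    _ = (m + n) * ((2 : ℝ) ^ (3 * L))⁻¹ := by
        simp only [Nat.card_Icc, Nat.add_sub_cancel, nsmul_eq_mul]; ring
    _ ≤ (2 * (n : ℝ) ^ 2) * (1 / (n : ℝ) ^ 3) := by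
        gcongr
        have h1 : (m : ℝ) ≤ n * n := by exact_mod_cast hmn.le
        have h2 : (n : ℝ) ≤ n * n := by exact_mod_cast Nat.le_mul_self n
        nlinarith
    _ = 2 / n := by field_simp

/-! ### Giving each chore to an agent who minds it least -/

/-- The columns of the matrix of disutilities are independent, each of them consisting of independent
draws from `D`. -/
theorem disutilityLaw_map_swap (D : Measure ℝ) [IsProbabilityMeasure D] (n m : ℕ) :
    (disutilityLaw D n m).map (fun d j i => d i j) =
      Measure.pi fun _ : Fin m => Measure.pi fun _ : Fin n => D := by
  symm
  refine Measure.pi_eq_generateFrom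
    (C := fun _ => Set.pi Set.univ '' Set.pi Set.univ fun _ : Fin n => {s : Set ℝ | MeasurableSet s})
    (fun _ => generateFrom_pi) (fun _ => isPiSystem_pi)
    (fun _ => Measure.FiniteSpanningSetsIn.pi fun _ => D.toFiniteSpanningSetsIn) ?_
  intro s hs
  choose b hb hbs using hs
  have hb' : ∀ j i, MeasurableSet (b j i) := fun j i => hb j i (Set.mem_univ i)
  obtain rfl : (fun j => Set.univ.pi (b j)) = s := funext hbs
  rw [Measure.map_apply (by fun_prop)
    (MeasurableSet.univ_pi fun j => MeasurableSet.univ_pi (hb' j))]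
  have hpre : (fun (d : Fin n → Fin m → ℝ) j i => d i j) ⁻¹'
      (Set.univ.pi fun j => Set.univ.pi (b j)) =
      Set.univ.pi fun i => Set.univ.pi fun j => b j i := by
    ext d; simp only [Set.mem_preimage, Set.mem_univ_pi]; exact forall_comm
  rw [hpre, disutilityLaw, Measure.pi_pi]
  simp only [Measure.pi_pi]
  exact Finset.prod_comm

variable {α β : ℝ}

theorem measurableSet_ofPred_forall {X ι : Type*} [MeasurableSpace X] [Countable ι] {p : ι → X → Prop}
    (h : ∀ k, MeasurableSet {x | p k x}) : MeasurableSet {x | ∀ k, p k x} := by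
  rw [show {x | ∀ k, p k x} = ⋂ k, {x | p k x} by ext; simp]
  exact MeasurableSet.iInter h

theorem measurableSet_forall_ne {p : Fin n → (Fin n → ℝ) → Prop} (i : Fin n)
    (h : ∀ k, MeasurableSet {x | p k x}) : MeasurableSet {x | ∀ k, k ≠ i → p k x} := by
  refine measurableSet_ofPred_forall fun k => ?_
  by_cases hk : k = i
  · simp [hk]
  · simpa [hk] using h k

theorem measurable_envyBound (i i' : Fin n) : Measurable (envyBound i i') := by
  classical
  unfold envyBound
  refine Measurable.sub (Measurable.ite ?_ (by fun_prop) measurable_const)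
    (Measurable.ite ?_ (by fun_prop) measurable_const)
  · exact measurableSet_ofPred_forall fun k => measurableSet_le (by fun_prop) (by fun_prop)
  · exact measurableSet_forall_ne i' fun k => measurableSet_lt (by fun_prop) (by fun_prop)

theorem column_ae_mem (h : IsPDFBoundedBy α β D) :
    ∀ᵐ x ∂(Measure.pi fun _ : Fin n => D), ∀ i, x i ∈ Set.Icc (0 : ℝ) 1 :=
  ae_all_iff.2 fun i => (Measure.tendsto_eval_ae_ae (i := i)).eventually h.ae_mem

theorem abs_envyBound_le {i i' : Fin n} {x : Fin n → ℝ} (hx : ∀ i, x i ∈ Set.Icc (0 : ℝ) 1) :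
    |envyBound i i' x| ≤ 1 := by
  have := hx i
  rw [envyBound, abs_le]
  split_ifs <;> constructor <;> linarith [this.1, this.2]

/-- Markov's inequality for the exponential moment. -/
theorem disutilityLaw_envy_le (h : IsPDFBoundedBy α β D) {l : ℝ} (hl : 0 ≤ l) (i i' : Fin n) :
    (disutilityLaw D n m).real {d | 0 < ∑ j, envyBound i i' (fun k => d k j)} ≤
      (∫ x, Real.exp (l * envyBound i i' x) ∂(Measure.pi fun _ : Fin n => D)) ^ m := by
  have hmeas := measurable_envyBound i i'
  have hint : Integrable (fun x => Real.exp (l * envyBound i i' x))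
      (Measure.pi fun _ : Fin n => D) := by
    refine Integrable.of_bound (by fun_prop) (Real.exp l) ?_
    filter_upwards [column_ae_mem h] with x hx
    rw [Real.norm_eq_abs, Real.abs_exp]
    exact Real.exp_le_exp.2 (by nlinarith [(abs_le.1 (abs_envyBound_le (i := i) (i' := i') hx)).2])
  set ν := Measure.pi fun _ : Fin m => Measure.pi fun _ : Fin n => D with hν
  have hprod : ∀ y : Fin m → Fin n → ℝ, Real.exp (l * ∑ j, envyBound i i' (y j)) =
      ∏ j, Real.exp (l * envyBound i i' (y j)) := fun y => by
    rw [Finset.mul_sum, Real.exp_sum]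
  have hint' : Integrable (fun y : Fin m → Fin n → ℝ =>
      Real.exp (l * ∑ j, envyBound i i' (y j))) ν := by
    simp only [hprod]
    exact Integrable.fintype_prod (f := fun _ x => Real.exp (l * envyBound i i' x)) fun _ => hint
  have hset : MeasurableSet {y : Fin m → Fin n → ℝ | 0 < ∑ j, envyBound i i' (y j)} :=
    measurableSet_lt measurable_const (Finset.measurable_fun_sum _ fun j _ =>
      hmeas.comp (measurable_pi_apply j))
  calc (disutilityLaw D n m).real {d | 0 < ∑ j, envyBound i i' (fun k => d k j)}
      = ν.real {y | 0 < ∑ j, envyBound i i' (y j)} := by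
        rw [hν, ← disutilityLaw_map_swap D n m, map_measureReal_apply (by fun_prop) hset]
        rfl
    _ ≤ ν.real {y | 0 ≤ ∑ j, envyBound i i' (y j)} :=
        measureReal_mono (by
          intro y hy
          rw [Set.mem_ofPred_eq] at hy ⊢
          exact hy.le) (measure_ne_top _ _)
    _ ≤ Real.exp (-l * 0) * ProbabilityTheory.mgf (fun y => ∑ j, envyBound i i' (y j)) ν l :=
        ProbabilityTheory.measure_ge_le_exp_mul_mgf 0 hl hint'
    _ = ∫ y, ∏ j, Real.exp (l * envyBound i i' (y j)) ∂ν := by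
        simp only [ProbabilityTheory.mgf, hprod]; simp
    _ = _ := by
        rw [hν, integral_fintype_prod_eq_pow (ι := Fin m) (fun x => Real.exp (l * envyBound i i' x)),
          Fintype.card_fin]

/-- The probability of a box in which one coordinate is in `X` and the others are in `Z`. -/
theorem column_box (i : Fin n) (X Z : Set ℝ) :
    (Measure.pi fun _ : Fin n => D).real {x | x i ∈ X ∧ ∀ k, k ≠ i → x k ∈ Z} =
      D.real X * D.real Z ^ (n - 1) := by
  have hset : {x : Fin n → ℝ | x i ∈ X ∧ ∀ k, k ≠ i → x k ∈ Z} =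
      Set.univ.pi fun k => if k = i then X else Z := by
    ext x
    simp only [Set.mem_ofPred_eq, Set.mem_univ_pi]
    constructor
    · rintro ⟨h1, h2⟩ k
      split_ifs with hk
      · rw [hk]; exact h1
      · exact h2 k hk
    · intro hx
      exact ⟨by simpa using hx i, fun k hk => by simpa [hk] using hx k⟩
  rw [hset, Measure.real, Measure.pi_pi, ENNReal.toReal_prod,
    ← Finset.mul_prod_erase _ _ (Finset.mem_univ i), if_pos rfl]
  rw [Finset.prod_congr rfl fun k hk => by rw [if_neg (Finset.ne_of_mem_erase hk)],
    Finset.prod_const, Finset.card_erase_of_mem (Finset.mem_univ i), Finset.card_univ,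
    Fintype.card_fin]
  rfl

/-- Cover the event that the disutility of `i` is the least by the boxes in which it lies in
`[k / n, (k + 1) / n]` and all others are at least `k / n`. -/
theorem exists_box {i : Fin n} {x : Fin n → ℝ} (hx : ∀ i, x i ∈ Set.Icc (0 : ℝ) 1)
    (hmin : ∀ k, x i ≤ x k) : ∃ k ∈ Finset.range (n + 1),
      x i ∈ Set.Icc ((k : ℝ) / n) ((k + 1) / n) ∧ ∀ k', k' ≠ i → x k' ∈ Set.Ici ((k : ℝ) / n) := by
  have hn : (0 : ℝ) < n := by exact_mod_cast i.pos
  have h0 : 0 ≤ n * x i := mul_nonneg hn.le (hx i).1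
  have h1 : ((⌊n * x i⌋₊ : ℕ) : ℝ) / n ≤ x i := by
    rw [div_le_iff₀ hn, mul_comm (x i)]; exact Nat.floor_le h0
  refine ⟨⌊n * x i⌋₊, ?_, ⟨h1, ?_⟩, fun k _ => h1.trans (hmin k)⟩
  · rw [Finset.mem_range, Nat.lt_succ_iff]
    have : n * x i ≤ n := by nlinarith [(hx i).2]
    exact (Nat.floor_le_floor this).trans (by simp)
  · rw [le_div_iff₀ hn, mul_comm (x i)]; exact (Nat.lt_floor_add_one _).le

theorem column_box_le (h : IsPDFBoundedBy α β D) (hα : 0 ≤ α) (hβ : 0 ≤ β) (hn : 2 ≤ n)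
    (i : Fin n) {k : ℕ} (hk : k ≤ n) :
    (Measure.pi fun _ : Fin n => D).real {x | x i ∈ Set.Icc ((k : ℝ) / n) ((k + 1) / n) ∧
      ∀ k', k' ≠ i → x k' ∈ Set.Ici ((k : ℝ) / n)} ≤ β / n * Real.exp (-(α / 2)) ^ k := by
  have hn0 : (0 : ℝ) < n := by exact_mod_cast (by omega : 0 < n)
  rw [column_box]
  have h1 : D.real (Set.Icc ((k : ℝ) / n) ((k + 1) / n)) ≤ β / n := by
    have := h.measureReal_le hβ measurableSet_Icc (a := (k : ℝ) / n) (b := (k + 1) / n)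
      (by gcongr; linarith) Set.inter_subset_left
    refine this.trans (le_of_eq ?_)
    field_simp; ring
  have h2 : D.real (Set.Ici ((k : ℝ) / n)) ≤ Real.exp (-(α * (k / n))) :=
    h.measureReal_Ici_le hα hβ (by rw [div_le_one hn0]; exact_mod_cast hk)
  calc _ ≤ β / n * Real.exp (-(α * (k / n))) ^ (n - 1) := by gcongr
    _ ≤ β / n * Real.exp (-(α / 2)) ^ k := by
        gcongr
        rw [← Real.exp_nat_mul, ← Real.exp_nat_mul]
        refine Real.exp_le_exp.2 ?_
        have h3 : (n : ℝ) ≤ 2 * ((n - 1 : ℕ) : ℝ) := by exact_mod_cast (by omega : n ≤ 2 * (n - 1))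
        have h4 : 1 / 2 ≤ ((n - 1 : ℕ) : ℝ) / n := by rw [le_div_iff₀ hn0]; linarith
        have h5 : 0 ≤ α * k := by positivity
        calc ((n - 1 : ℕ) : ℝ) * -(α * (k / n)) = -(α * k * (((n - 1 : ℕ) : ℝ) / n)) := by ring
          _ ≤ -(α * k * (1 / 2)) := by gcongr
          _ = k * -(α / 2) := by ring

theorem column_least_le (h : IsPDFBoundedBy α β D) (hα : 0 ≤ α) (hβ : 0 ≤ β) (hn : 2 ≤ n) {K : ℝ}
    (hK : ∀ N, ∑ k ∈ Finset.range N, ((k : ℝ) + 1) * Real.exp (-(α / 2)) ^ k ≤ K) (i : Fin n) :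
    (Measure.pi fun _ : Fin n => D).real {x | ∀ k, x i ≤ x k} ≤ β * K / n := by
  set Q := Measure.pi fun _ : Fin n => D with hQ
  set box : ℕ → Set (Fin n → ℝ) := fun k => {x | x i ∈ Set.Icc ((k : ℝ) / n) ((k + 1) / n) ∧
      ∀ k', k' ≠ i → x k' ∈ Set.Ici ((k : ℝ) / n)} with hbox
  calc Q.real {x | ∀ k, x i ≤ x k} ≤ Q.real (⋃ k ∈ Finset.range (n + 1), box k) := by
        refine ENNReal.toReal_mono (measure_ne_top _ _) (measure_mono_ae ?_)
        filter_upwards [column_ae_mem h] with x hx hmin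
        obtain ⟨k, hk, h1⟩ := exists_box hx hmin
        exact Set.mem_iUnion₂.2 ⟨k, hk, h1⟩
    _ ≤ ∑ k ∈ Finset.range (n + 1), Q.real (box k) := measureReal_biUnion_finset_le _ _
    _ ≤ ∑ k ∈ Finset.range (n + 1), β / n * (((k : ℝ) + 1) * Real.exp (-(α / 2)) ^ k) := by
        refine Finset.sum_le_sum fun k hk => ?_
        refine (column_box_le h hα hβ hn i (by simpa [Nat.lt_succ_iff] using hk)).trans ?_
        gcongr
        exact le_mul_of_one_le_left (by positivity) (by linarith [k.cast_nonneg (α := ℝ)])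
    _ ≤ β * K / n := by
        rw [← Finset.mul_sum, mul_div_right_comm]
        gcongr
        exact hK _

open Classical in
theorem integral_least_le (h : IsPDFBoundedBy α β D) (hα : 0 ≤ α) (hβ : 0 ≤ β) (hn : 2 ≤ n) {K : ℝ}
    (hK : ∀ N, ∑ k ∈ Finset.range N, ((k : ℝ) + 1) * Real.exp (-(α / 2)) ^ k ≤ K) (i : Fin n) :
    ∫ x, (if ∀ k, x i ≤ x k then x i else 0) ∂(Measure.pi fun _ : Fin n => D) ≤
      β * K / (n : ℝ) ^ 2 := by
  have hn0 : (0 : ℝ) < n := by exact_mod_cast (by omega : 0 < n)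
  set Q := Measure.pi fun _ : Fin n => D with hQ
  set box : ℕ → Set (Fin n → ℝ) := fun k => {x | x i ∈ Set.Icc ((k : ℝ) / n) ((k + 1) / n) ∧
      ∀ k', k' ≠ i → x k' ∈ Set.Ici ((k : ℝ) / n)} with hbox
  have hmeas : ∀ k, MeasurableSet (box k) := fun k => by
    refine MeasurableSet.inter ?_ (measurableSet_forall_ne i fun k' => ?_)
    · exact measurable_pi_apply i measurableSet_Icc
    · exact measurable_pi_apply k' measurableSet_Ici
  have hint : ∀ k ∈ Finset.range (n + 1),
      Integrable ((box k).indicator fun _ => ((k : ℝ) + 1) / n) Q := fun k _ =>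
    (integrable_const _).indicator (hmeas k)
  calc ∫ x, (if ∀ k, x i ≤ x k then x i else 0) ∂Q
      ≤ ∫ x, ∑ k ∈ Finset.range (n + 1), (box k).indicator (fun _ => ((k : ℝ) + 1) / n) x ∂Q := by
        refine integral_mono_of_nonneg ?_ (integrable_finsetSum _ hint) ?_
        · filter_upwards [column_ae_mem h] with x hx
          simp only [Pi.zero_apply]
          split_ifs
          · exact (hx i).1
          · exact le_rfl
        · filter_upwards [column_ae_mem h] with x hx
          have hnonneg : ∀ k ∈ Finset.range (n + 1),
              0 ≤ (box k).indicator (fun _ => ((k : ℝ) + 1) / n) x := fun k _ =>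
            Set.indicator_nonneg (fun _ _ => by positivity) x
          split_ifs with hmin
          · obtain ⟨k, hk, h1⟩ := exists_box hx hmin
            refine le_trans ?_ (Finset.single_le_sum hnonneg hk)
            rw [Set.indicator_of_mem (show x ∈ box k from h1)]
            exact h1.1.2
          · exact Finset.sum_nonneg hnonneg
    _ = ∑ k ∈ Finset.range (n + 1), Q.real (box k) * (((k : ℝ) + 1) / n) := by
        rw [integral_finsetSum _ hint]
        refine Finset.sum_congr rfl fun k _ => ?_
        rw [integral_indicator_const _ (hmeas k), smul_eq_mul]
    _ ≤ ∑ k ∈ Finset.range (n + 1), β / n * Real.exp (-(α / 2)) ^ k * (((k : ℝ) + 1) / n) := by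
        refine Finset.sum_le_sum fun k hk => ?_
        gcongr
        exact column_box_le h hα hβ hn i (by simpa [Nat.lt_succ_iff] using hk)
    _ = β / (n : ℝ) ^ 2 * ∑ k ∈ Finset.range (n + 1), ((k : ℝ) + 1) * Real.exp (-(α / 2)) ^ k := by
        rw [Finset.mul_sum]
        refine Finset.sum_congr rfl fun k _ => ?_
        field_simp
    _ ≤ β * K / (n : ℝ) ^ 2 := by
        rw [mul_div_right_comm]
        gcongr
        exact hK _

open Classical in
/-- With constant probability times `1 / n`, agent `i'` is the one who minds a chore least and agent
`i` minds it by more than `1 / 2`. -/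
theorem le_integral_other (h : IsPDFBoundedBy α β D) (hα : 0 < α) (hβ : 0 < β) (hn : 2 ≤ n)
    (hnβ : 1 ≤ β * n) {i i' : Fin n} (hne : i ≠ i') :
    α ^ 2 / (16 * β) / n ≤
      ∫ x, (if ∀ k, k ≠ i' → x i' < x k then x i else 0) ∂(Measure.pi fun _ : Fin n => D) := by
  have hn0 : (0 : ℝ) < n := by exact_mod_cast (by omega : 0 < n)
  have hn2 : (2 : ℝ) ≤ n := by exact_mod_cast hn
  set Q := Measure.pi fun _ : Fin n => D with hQ
  -- at this level, all the other agents are above with probability at least `1 / 2`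
  set w : ℝ := 1 / (2 * β * n) with hw
  have hw0 : 0 < w := by positivity
  have hw1 : w ≤ 1 / 2 := by
    rw [hw]; gcongr; linarith
  set box : Set (Fin n → ℝ) := Set.univ.pi fun k =>
    if k = i' then Set.Iic w else if k = i then Set.Ioi (1 / 2) else Set.Ioi w with hbox
  have hmeas : MeasurableSet box := MeasurableSet.univ_pi fun k => by
    split_ifs
    exacts [measurableSet_Iic, measurableSet_Ioi, measurableSet_Ioi]
  have hprob : α ^ 2 / (8 * β) / n ≤ Q.real box := by
    have h1 : α * w ≤ D.real (Set.Iic w) := by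
      simpa using h.le_measureReal hα.le le_rfl (by linarith) Set.Icc_subset_Iic_self
    have h2 : α * (1 / 2) ≤ D.real (Set.Ioi (1 / 2)) := by
      have h3 := h.measureReal_Ici_le_Ioi hβ.le (1 / 2)
      have h6 : α * (1 - 1 / 2) ≤ D.real (Set.Ici (1 / 2)) :=
        h.le_measureReal hα.le (by norm_num) le_rfl Set.Icc_subset_Ici_self
      linarith
    have h3 : 1 - β * w ≤ D.real (Set.Ioi w) := by
      have h4 := measureReal_compl (μ := D) (s := Set.Iic w) measurableSet_Iic
      rw [Set.compl_Iic, probReal_univ] at h4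
      linarith [h.measureReal_Iic_le hβ.le hw0.le]
    have h4 : 1 / 2 ≤ D.real (Set.Ioi w) ^ (n - 2) := by
      have hβw : β * w = 1 / (2 * n) := by rw [hw]; field_simp
      have h5 : 0 ≤ 1 - β * w := by
        rw [hβw, sub_nonneg, div_le_one (by positivity)]; linarith
      calc (1 : ℝ) / 2 = 1 + n * -(β * w) := by rw [hβw]; field_simp; norm_num
        _ ≤ (1 + -(β * w)) ^ n := one_add_mul_le_pow (by linarith) n
        _ ≤ (1 - β * w) ^ (n - 2) := by
            rw [← sub_eq_add_neg]
            exact pow_le_pow_of_le_one h5 (by linarith [mul_pos hβ hw0]) (by omega)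
        _ ≤ _ := by gcongr
    have hprod : Q.real box =
        D.real (Set.Iic w) * (D.real (Set.Ioi (1 / 2)) * D.real (Set.Ioi w) ^ (n - 2)) := by
      rw [hQ, hbox, Measure.real, Measure.pi_pi, ENNReal.toReal_prod,
        ← Finset.mul_prod_erase _ _ (Finset.mem_univ i'),
        ← Finset.mul_prod_erase _ _ (Finset.mem_erase.2 ⟨hne, Finset.mem_univ i⟩), if_pos rfl,
        if_neg hne, if_pos rfl]
      rw [Finset.prod_congr rfl fun k hk => by
          rw [if_neg (Finset.ne_of_mem_erase (Finset.mem_of_mem_erase hk)),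
            if_neg (Finset.ne_of_mem_erase hk)],
        Finset.prod_const, Finset.card_erase_of_mem (Finset.mem_erase.2 ⟨hne, Finset.mem_univ i⟩),
        Finset.card_erase_of_mem (Finset.mem_univ i'), Finset.card_univ, Fintype.card_fin,
        Nat.sub_sub]
      rfl
    rw [hprod]
    calc α ^ 2 / (8 * β) / n = α * w * (α * (1 / 2) * (1 / 2)) := by rw [hw]; field_simp; norm_num
      _ ≤ _ := by gcongr
  calc α ^ 2 / (16 * β) / n = α ^ 2 / (8 * β) / n * (1 / 2) := by field_simp; norm_num
    _ ≤ Q.real box * (1 / 2) := by gcongr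
    _ = ∫ x, box.indicator (fun _ => (1 / 2 : ℝ)) x ∂Q := by
        rw [integral_indicator_const _ hmeas, smul_eq_mul]
    _ ≤ _ := by
        refine integral_mono_ae ((integrable_const _).indicator hmeas) ?_ ?_
        · refine Integrable.of_bound ?_ 1 ?_
          · refine (Measurable.ite ?_ (by fun_prop) measurable_const).aestronglyMeasurable
            exact measurableSet_forall_ne i' fun k => measurableSet_lt (by fun_prop) (by fun_prop)
          · filter_upwards [column_ae_mem h] with x hx
            rw [Real.norm_eq_abs, abs_le]
            split_ifs <;> constructor <;> linarith [(hx i).1, (hx i).2]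
        · filter_upwards [column_ae_mem h] with x hx
          by_cases hb : x ∈ box
          · rw [Set.indicator_of_mem hb]
            simp only [hbox, Set.mem_univ_pi] at hb
            have h1 : x i' ≤ w := by simpa using hb i'
            have h2 : 1 / 2 < x i := by simpa [hne] using hb i
            rw [if_pos]
            · exact h2.le
            · intro k hk
              have h3 := hb k
              rw [if_neg hk] at h3
              by_cases hki : k = i
              · subst hki; linarith
              · rw [if_neg hki] at h3
                exact h1.trans_lt h3
          · rw [Set.indicator_of_notMem hb]
            split_ifs
            · exact (hx i).1
            · exact le_rfl

open Classical in
/-- The envy caused by a single chore is negative in the mean, by an amount of order `1 / n`, and has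
second moment `O(1 / n)`. This bounds its exponential moment. -/
theorem exists_integral_exp_envyBound_le (h : IsPDFBoundedBy α β D) (hα : 0 < α) (hβ : 0 < β) :
    ∃ κ > 0, ∃ l ≥ 0, ∃ n₀ : ℕ, ∀ n ≥ n₀, ∀ i i' : Fin n, i ≠ i' →
      ∫ x, Real.exp (l * envyBound i i' x) ∂(Measure.pi fun _ : Fin n => D) ≤
        Real.exp (-(κ / n)) := by
  set r := Real.exp (-(α / 2)) with hr
  have hr0 : 0 < r := Real.exp_pos _
  have hr1 : r < 1 := by
    rw [hr, ← Real.exp_zero]; exact Real.exp_lt_exp.2 (by linarith)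
  have hsummable : Summable fun k : ℕ => ((k : ℝ) + 1) * r ^ k := by
    have h1 := summable_pow_mul_geometric_of_norm_lt_one 1
      (r := r) (by rwa [Real.norm_eq_abs, abs_of_pos hr0])
    have h2 := summable_geometric_of_lt_one hr0.le hr1
    refine (h1.add h2).congr fun k => ?_
    ring
  set K := ∑' k : ℕ, ((k : ℝ) + 1) * r ^ k with hKdef
  have hK : ∀ N, ∑ k ∈ Finset.range N, ((k : ℝ) + 1) * r ^ k ≤ K := fun N =>
    hsummable.sum_le_tsum _ fun k _ => by positivity
  have hK1 : 1 ≤ K := by simpa using hK 1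
  set c := α ^ 2 / (16 * β) with hc
  have hc0 : 0 < c := by positivity
  -- small enough for the second-order term, at most `2 * β * K * l ^ 2 / n`, to be at most half of the
  -- first-order term `c * l / (2 * n)`
  set l := min 1 (c / (8 * (β * K))) with hl
  have hβK : 0 < β * K := by positivity
  have hl0 : 0 < l := lt_min one_pos (by positivity)
  have hl1 : l ≤ 1 := min_le_left _ _
  have hl2 : l * (8 * (β * K)) ≤ c := by
    rw [← le_div_iff₀ (by positivity)]; exact min_le_right _ _
  refine ⟨l * c / 4, by positivity, l, hl0.le, max 2 (max ⌈1 / β⌉₊ ⌈2 * (β * K) / c⌉₊),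
    fun n hn i i' hne => ?_⟩
  have hn2 : 2 ≤ n := (le_max_left _ _).trans hn
  have hnβ : 1 ≤ β * n := by
    have h1 := Nat.ceil_le.1 (((le_max_left _ _).trans (le_max_right _ _)).trans hn)
    rw [div_le_iff₀ hβ] at h1; linarith
  have hnK : 2 * (β * K) ≤ c * n := by
    have h1 := Nat.ceil_le.1 (((le_max_right _ _).trans (le_max_right _ _)).trans hn)
    rw [div_le_iff₀ hc0] at h1; linarith
  have hn0 : (0 : ℝ) < n := by exact_mod_cast (by omega : 0 < n)
  set Q := Measure.pi fun _ : Fin n => D with hQ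
  set U : (Fin n → ℝ) → ℝ := fun x => if ∀ k, x i ≤ x k then x i else 0 with hU
  set V : (Fin n → ℝ) → ℝ := fun x => if ∀ k, k ≠ i' → x i' < x k then x i else 0 with hV
  set M : Fin n → Set (Fin n → ℝ) := fun i => {x | ∀ k, x i ≤ x k} with hM
  have hMmeas : ∀ i, MeasurableSet (M i) := fun i =>
    measurableSet_ofPred_forall fun k => measurableSet_le (by fun_prop) (by fun_prop)
  have hUint : Integrable U Q := by
    refine Integrable.of_bound
      (Measurable.ite (hMmeas i) (by fun_prop) measurable_const).aestronglyMeasurable 1 ?_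
    filter_upwards [column_ae_mem h] with x hx
    rw [Real.norm_eq_abs, abs_le]
    simp only [hU]
    split_ifs <;> constructor <;> linarith [(hx i).1, (hx i).2]
  have hVint : Integrable V Q := by
    refine Integrable.of_bound (Measurable.ite (measurableSet_forall_ne i' fun k =>
      measurableSet_lt (by fun_prop) (by fun_prop))
      (by fun_prop) measurable_const).aestronglyMeasurable 1 ?_
    filter_upwards [column_ae_mem h] with x hx
    rw [Real.norm_eq_abs, abs_le]
    simp only [hV]
    split_ifs <;> constructor <;> linarith [(hx i).1, (hx i).2]
  have hMint : ∀ i, Integrable ((M i).indicator fun _ => (1 : ℝ)) Q := fun i =>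
    (integrable_const _).indicator (hMmeas i)
  have hpoint : ∀ᵐ x ∂Q, Real.exp (l * envyBound i i' x) ≤
      1 + l * (U x - V x) +
        l ^ 2 * ((M i).indicator (fun _ => (1 : ℝ)) x + (M i').indicator (fun _ => (1 : ℝ)) x) := by
    filter_upwards [column_ae_mem h] with x hx
    have hY : envyBound i i' x = U x - V x := rfl
    have habs := abs_envyBound_le (i := i) (i' := i') hx
    have h1 : |l * envyBound i i' x| ≤ 1 := by
      rw [abs_mul, abs_of_pos hl0]
      exact mul_le_one₀ hl1 (abs_nonneg _) habs
    have h2 := (abs_le.1 (Real.abs_exp_sub_one_sub_id_le h1)).2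
    have h3 : envyBound i i' x ^ 2 ≤
        (M i).indicator (fun _ => (1 : ℝ)) x + (M i').indicator (fun _ => (1 : ℝ)) x := by
      have hn1 := Set.indicator_nonneg (s := M i) (f := fun _ => (1 : ℝ)) (fun _ _ => zero_le_one) x
      have hn2 := Set.indicator_nonneg (s := M i') (f := fun _ => (1 : ℝ)) (fun _ _ => zero_le_one) x
      by_cases hu : x ∈ M i
      · rw [Set.indicator_of_mem hu]
        have := sq_le_one_iff_abs_le_one _ |>.2 habs
        linarith
      · by_cases hv : x ∈ M i'
        · rw [Set.indicator_of_mem hv]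
          have := sq_le_one_iff_abs_le_one _ |>.2 habs
          linarith
        · have h0 : envyBound i i' x = 0 := by
            rw [hY]
            simp only [hU, hV]
            rw [if_neg (show ¬ ∀ k, x i ≤ x k from hu), if_neg, sub_zero]
            refine fun hlt => hv fun k => ?_
            rcases eq_or_ne k i' with rfl | hk
            · exact le_rfl
            · exact (hlt k hk).le
          rw [h0]; linarith
    rw [hY] at h2 h3 ⊢
    have h4 : (l * (U x - V x)) ^ 2 ≤ l ^ 2 * ((M i).indicator (fun _ => (1 : ℝ)) x +
        (M i').indicator (fun _ => (1 : ℝ)) x) := by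
      rw [mul_pow]; gcongr
    linarith
  have hfirst : Integrable (fun x => 1 + l * (U x - V x)) Q :=
    (integrable_const _).add ((hUint.sub hVint).const_mul _)
  have hsecond : Integrable (fun x => l ^ 2 * ((M i).indicator (fun _ => (1 : ℝ)) x +
      (M i').indicator (fun _ => (1 : ℝ)) x)) Q := ((hMint i).add (hMint i')).const_mul _
  have hU' := integral_least_le h hα.le hβ.le hn2 hK i
  have hV' := le_integral_other h hα hβ hn2 hnβ hne
  have hM' := fun i => column_least_le h hα.le hβ.le hn2 hK i
  have hUV : β * K / (n : ℝ) ^ 2 ≤ c / 2 / n := by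
    rw [div_le_div_iff₀ (by positivity) hn0]
    nlinarith
  calc ∫ x, Real.exp (l * envyBound i i' x) ∂Q
      ≤ ∫ x, 1 + l * (U x - V x) + l ^ 2 * ((M i).indicator (fun _ => (1 : ℝ)) x +
          (M i').indicator (fun _ => (1 : ℝ)) x) ∂Q :=
        integral_mono_of_nonneg (ae_of_all _ fun x => (Real.exp_pos _).le)
          (hfirst.add hsecond) hpoint
    _ = 1 + l * (∫ x, U x ∂Q - ∫ x, V x ∂Q) + l ^ 2 * (Q.real (M i) + Q.real (M i')) := by
        have e : ∫ x, 1 + l * (U x - V x) ∂Q = 1 + l * (∫ x, U x ∂Q - ∫ x, V x ∂Q) := by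
          have := integral_add (integrable_const (1 : ℝ)) ((hUint.sub hVint).const_mul l)
          simp only [Pi.sub_apply] at this
          rw [this, integral_const_mul, integral_sub hUint hVint]
          simp
        rw [integral_add hfirst hsecond, e, integral_const_mul, integral_add (hMint i) (hMint i'),
          integral_indicator_const _ (hMmeas i), integral_indicator_const _ (hMmeas i')]
        simp
    _ ≤ 1 + l * (c / 2 / n - c / n) + l ^ 2 * (β * K / n + β * K / n) := by
        gcongr
        · exact hU'.trans hUV
        · exact hM' i
        · exact hM' i'
    _ ≤ 1 + -(l * c / 4 / n) := by
        have : l ^ 2 * (β * K / n + β * K / n) ≤ l * (c / 4) / n := by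
          rw [← add_div, ← mul_div_assoc]
          refine div_le_div_of_nonneg_right ?_ hn0.le
          nlinarith [mul_le_mul_of_nonneg_left hl2 hl0.le]
        have e : l * (c / 2 / n - c / n) = -(l * (c / 2) / n) := by ring
        rw [e]
        have e' : l * (c / 2) / n = l * (c / 4) / n + l * c / 4 / n := by ring
        linarith
    _ ≤ Real.exp (-(l * c / 4 / n)) := by
        linarith [Real.add_one_le_exp (-(l * c / 4 / n))]

/-! ### The failure probability -/

theorem disutilityLaw_exists_envy_le (h : IsPDFBoundedBy α β D) {κ l : ℝ} (hκ : 0 < κ) (hl : 0 ≤ l)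
    (hn : 1 ≤ n) (hexp : ∀ i i' : Fin n, i ≠ i' →
      ∫ x, Real.exp (l * envyBound i i' x) ∂(Measure.pi fun _ : Fin n => D) ≤ Real.exp (-(κ / n)))
    (hm : ⌈3 / κ⌉₊ * n * (Nat.log 2 n + 1) ≤ m) :
    (disutilityLaw D n m).real
      {d | ∃ i i', i ≠ i' ∧ 0 < ∑ j, envyBound i i' (fun k => d k j)} ≤ 1 / n := by
  have hn0 : (0 : ℝ) < n := by exact_mod_cast hn
  set L := Nat.log 2 n + 1 with hL
  have hnL : n < 2 ^ L := Nat.lt_pow_succ_log_self (by norm_num) n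
  have hset : {d : Fin n → Fin m → ℝ | ∃ i i', i ≠ i' ∧ 0 < ∑ j, envyBound i i' (fun k => d k j)} =
      ⋃ c ∈ Finset.univ.filter fun c : Fin n × Fin n => c.1 ≠ c.2,
        {d | 0 < ∑ j, envyBound c.1 c.2 (fun k => d k j)} := by
    ext d; simp
  have hterm : ∀ c ∈ Finset.univ.filter fun c : Fin n × Fin n => c.1 ≠ c.2,
      (disutilityLaw D n m).real {d | 0 < ∑ j, envyBound c.1 c.2 (fun k => d k j)} ≤
        1 / (n : ℝ) ^ 3 := by
    intro c hc
    refine (disutilityLaw_envy_le h hl c.1 c.2).trans ?_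
    calc (∫ x, Real.exp (l * envyBound c.1 c.2 x) ∂(Measure.pi fun _ : Fin n => D)) ^ m
        ≤ Real.exp (-(κ / n)) ^ m := by
          gcongr
          exact hexp _ _ (Finset.mem_filter.1 hc).2
      _ = Real.exp (-(m * (κ / n))) := by rw [← Real.exp_nat_mul]; congr 1; ring
      _ ≤ Real.exp (-((3 * L : ℕ) : ℝ)) := by
          refine Real.exp_le_exp.2 (neg_le_neg ?_)
          have h1 : 3 / κ ≤ (⌈3 / κ⌉₊ : ℝ) := Nat.le_ceil _
          have h2 : ((⌈3 / κ⌉₊ : ℝ) * n * L) ≤ m := by exact_mod_cast hm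
          calc ((3 * L : ℕ) : ℝ) = (3 / κ * n * L) * (κ / n) := by push_cast; field_simp
            _ ≤ (⌈3 / κ⌉₊ * n * L) * (κ / n) := by gcongr
            _ ≤ m * (κ / n) := by gcongr
      _ ≤ ((2 : ℝ) ^ (3 * L))⁻¹ := exp_neg_natCast_le _
      _ ≤ 1 / (n : ℝ) ^ 3 := by
          rw [one_div]
          refine inv_anti₀ (by positivity) ?_
          rw [mul_comm, pow_mul]
          gcongr
          exact_mod_cast hnL.le
  rw [hset]
  calc _ ≤ ∑ c ∈ Finset.univ.filter fun c : Fin n × Fin n => c.1 ≠ c.2,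
        (disutilityLaw D n m).real {d | 0 < ∑ j, envyBound c.1 c.2 (fun k => d k j)} :=
        measureReal_biUnion_finset_le _ _
    _ ≤ (Finset.univ.filter fun c : Fin n × Fin n => c.1 ≠ c.2).card • (1 / (n : ℝ) ^ 3) :=
        Finset.sum_le_card_nsmul _ _ _ hterm
    _ ≤ ((n : ℝ) * n) * (1 / (n : ℝ) ^ 3) := by
        rw [nsmul_eq_mul]
        gcongr
        have := Finset.card_filter_le (Finset.univ : Finset (Fin n × Fin n)) fun c => c.1 ≠ c.2
        rw [Finset.card_univ, Fintype.card_prod, Fintype.card_fin] at this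
        exact_mod_cast this
    _ = 1 / n := by field_simp

theorem tendsto_log_pow_div : Tendsto (fun n : ℕ => ((Nat.log 2 n + 1 : ℕ) : ℝ) ^ 13 / n) atTop (𝓝 0) := by
  have h1 : Tendsto (fun n : ℕ => 3 ^ 13 * (Real.log n ^ 13 / (n : ℝ))) atTop (𝓝 (3 ^ 13 * 0)) :=
    ((Real.isLittleO_pow_log_id_atTop (n := 13)).tendsto_div_nhds_zero.comp
      tendsto_natCast_atTop_atTop).const_mul _
  rw [mul_zero] at h1
  refine squeeze_zero' (.of_forall fun n => by positivity) ?_ h1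
  filter_upwards [eventually_ge_atTop 3] with n hn
  have hn3 : (3 : ℝ) ≤ n := by exact_mod_cast hn
  have hlog : 1 ≤ Real.log n := by
    rw [Real.le_log_iff_exp_le (by linarith)]
    linarith [Real.exp_one_lt_d9]
  have h2 : ((Nat.log 2 n + 1 : ℕ) : ℝ) ≤ 3 * Real.log n := by
    have h3 : (Nat.log 2 n : ℝ) * Real.log 2 ≤ Real.log n := by
      rw [← Real.log_pow]
      refine Real.log_le_log (by positivity) ?_
      exact_mod_cast Nat.pow_log_le_self 2 (by omega)
    have h4 := Real.log_two_gt_d9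
    push_cast
    nlinarith [(Nat.log 2 n).cast_nonneg (α := ℝ)]
  rw [← mul_div_assoc, ← mul_pow]
  gcongr

/-- The allocation program finds an envy-free allocation with high probability. -/
theorem allocate_withHighProbability (h : IsPDFBoundedBy α β D) (hα : 0 < α) (hβ : 0 < β) :
    ∃ C C' : ℕ, ∀ m : ℕ → ℕ, (∀ n, 2 * n ≤ m n) →
      WithHighProbability D m (FindsEnvyFree (allocate C C').toProgram) := by
  obtain ⟨κ, hκ, l, hl, n₀, hexp⟩ := exists_integral_exp_envyBound_le h hα hβ
  -- `C` makes the threshold large enough for Hall's condition, and `C'` the number of chores large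
  -- enough for a failure probability of at most `n⁻³` per pair of agents
  set C := ⌈144 / α⌉₊ with hC
  set C' := ⌈3 / κ⌉₊ with hC'
  have hC1 : 144 / α ≤ (C : ℝ) := Nat.le_ceil _
  have hC'1 : 1 ≤ C' := Nat.ceil_pos.2 (by positivity)
  refine ⟨C, C', fun m hm => ?_⟩
  set B : ℝ := 25 * 2 ^ 16 * ((3 * β * C + 1) ^ 9 * (C' : ℝ) ^ 4) with hB
  have hlim : Tendsto (fun n : ℕ => B * (((Nat.log 2 n + 1 : ℕ) : ℝ) ^ 13 / n) + 3 / n) atTop (𝓝 0) := by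
    have h1 := (tendsto_log_pow_div.const_mul B).add (tendsto_const_div_atTop_nhds_zero_nat 3)
    simpa using h1
  have hsmall : ∀ᶠ n : ℕ in atTop, ((Nat.log 2 n + 1 : ℕ) : ℝ) ^ 13 / n < 1 / (C + C') :=
    tendsto_log_pow_div.eventually_lt_const (by positivity)
  have hlim' := ENNReal.tendsto_ofReal hlim
  rw [ENNReal.ofReal_zero] at hlim'
  refine tendsto_of_tendsto_of_tendsto_of_le_of_le' tendsto_const_nhds hlim'
    (.of_forall fun n => zero_le) ?_
  filter_upwards [hsmall, eventually_ge_atTop 12, eventually_ge_atTop n₀] with n hsmall hn12 hnn₀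
  have hn1 : 1 ≤ n := by omega
  have hn0 : (0 : ℝ) < n := by exact_mod_cast hn1
  set L := Nat.log 2 n + 1 with hL
  have hnL : n < 2 ^ L := Nat.lt_pow_succ_log_self (by norm_num) n
  have hL1 : (1 : ℝ) ≤ L := by exact_mod_cast Nat.le_add_left 1 _
  have hCL : ((C : ℝ) + C') * L < n := by
    rw [div_lt_div_iff₀ hn0 (by positivity), one_mul] at hsmall
    calc ((C : ℝ) + C') * L = L ^ 1 * (C + C') := by ring
      _ ≤ (L : ℝ) ^ 13 * (C + C') := by gcongr; norm_num
      _ < n := hsmall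
  set μ := disutilityLaw D n (m n) with hμ
  rw [← ENNReal.ofReal_toReal (measure_ne_top μ _)]
  refine ENNReal.ofReal_le_ofReal ?_
  change μ.real {d | ¬ FindsEnvyFree (allocate C C').toProgram n (m n) d} ≤ _
  have mono : ∀ S : Set (Fin n → Fin (m n) → ℝ),
      (∀ d : Fin n → Fin (m n) → ℝ, (∀ i j, 0 ≤ d i j) → d ∉ S →
        FindsEnvyFree (allocate C C').toProgram n (m n) d) →
      μ.real {d | ¬ FindsEnvyFree (allocate C C').toProgram n (m n) d} ≤ μ.real S := by
    intro S hS
    refine ENNReal.toReal_mono (measure_ne_top _ _) (measure_mono_ae ?_)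
    filter_upwards [disutilityLaw_ae_nonneg h] with d hd hnot
    by_contra hdS
    exact hnot (hS d hd hdS)
  rcases le_or_gt (C' * n * L) (m n) with hmany | hfew
  · refine (mono {d | ∃ i i', i ≠ i' ∧ 0 < ∑ j, envyBound i i' (fun k => d k j)} fun d hd hdS =>
      allocate_findsEnvyFree hn1 (hm n) hd (fun _ i i' hne => ?_) fun hlt =>
        absurd hmany (not_le.2 hlt)).trans ?_
    · by_contra hpos
      exact hdS ⟨i, i', hne, not_le.1 hpos⟩
    · refine (disutilityLaw_exists_envy_le h hκ hl hn1 (hexp n hnn₀) hmany).trans ?_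
      have h1 : (1 : ℝ) / n ≤ 3 / n := by gcongr; norm_num
      have h2 : 0 ≤ B * ((L : ℝ) ^ 13 / n) := by positivity
      linarith
  · set τ : ℝ := ((C * L : ℕ) : ℝ) / n with hτ
    have hτ0 : 0 ≤ τ := by positivity
    have hτ1 : τ ≤ 1 := by
      rw [hτ, div_le_one hn0]; push_cast
      nlinarith [mul_nonneg (Nat.cast_nonneg (α := ℝ) C') (zero_le_one.trans hL1)]
    have hmn : m n < n * n := by
      have h1 : C' * L ≤ n := by
        have : (C' : ℝ) * L ≤ n := by
          nlinarith [mul_nonneg (Nat.cast_nonneg (α := ℝ) C) (zero_le_one.trans hL1)]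
        exact_mod_cast this
      calc m n < C' * n * L := hfew
        _ = C' * L * n := by ring
        _ ≤ n * n := Nat.mul_le_mul_right _ h1
    refine (mono ({d | HasDenseSpot d (3 * τ)} ∪ {d | ¬ HasDenseSpot d (3 * τ) ∧ ¬ AgentHall d τ})
      fun d hd hdS => allocate_findsEnvyFree hn1 (hm n) hd (fun hle => absurd hle (not_le.2 hfew))
        fun _ => ?_).trans ?_
    · by_contra hhall
      by_cases hdense : HasDenseSpot d (3 * τ)
      · exact hdS (.inl hdense)
      · exact hdS (.inr ⟨hdense, hhall⟩)
    · refine (measureReal_union_le _ _).trans ?_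
      have h1 := disutilityLaw_hasDenseSpot_le (D := D) (n := n) (m := m n) (t := 3 * τ)
        (x := (3 * β * C + 1) * L) (y := C' * L) hn1
        (one_le_mul_of_one_le_of_one_le (by linarith [show 0 ≤ 3 * β * C by positivity]) hL1)
        (one_le_mul_of_one_le_of_one_le (by exact_mod_cast hC'1) hL1)
        ((h.measureReal_Iic_le hβ.le (by positivity)).trans (by
          rw [hτ, ← mul_div_assoc, ← mul_div_assoc]
          refine div_le_div_of_nonneg_right ?_ hn0.le
          push_cast
          linarith))
        (by
          have : ((m n : ℕ) : ℝ) ≤ C' * n * L := by exact_mod_cast hfew.le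
          linarith)
      have h2 := disutilityLaw_not_agentHall_le (D := D) (n := n) (m := m n) (α := α) (τ := τ) (L := L)
        hn12 (hm n) (Nat.le_add_left 1 _) hnL hmn
        (by
          have e : α * τ * n = α * C * L := by rw [hτ]; push_cast; field_simp
          rw [e]
          rw [div_le_iff₀ hα] at hC1
          gcongr
          linarith)
        (h.measureReal_Ioi_le hα.le hτ1)
      have e : 25 * 2 ^ 16 * (((3 * β * C + 1) * L) ^ 9 * (C' * L) ^ 4) / n =
          B * ((L : ℝ) ^ 13 / n) := by rw [hB]; ring
      rw [e] at h1
      have h3 : (2 : ℝ) / n ≤ 3 / n := by gcongr; norm_num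
      linarith

end ChoreDivision

theorem theorem1 (D : Measure ℝ) [IsProbabilityMeasure D] (hD : ChoreDivision.IsPDFBounded D) :
    (∀ m : ℕ → ℕ, (∀ n : ℕ, 2 * n ≤ m n) →
      ChoreDivision.WithHighProbability D m fun n m d =>
        ∃ A : Fin n → Finset (Fin m),
          ChoreDivision.IsAllocation A ∧ ChoreDivision.IsEnvyFree d A) ∧
    ∃ P : ChoreDivision.Program, ChoreDivision.RunsInPolyTime P ∧
      ∀ m : ℕ → ℕ, (∀ n : ℕ, 2 * n ≤ m n) →
        ChoreDivision.WithHighProbability D m (ChoreDivision.FindsEnvyFree P) := by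
  obtain ⟨α, β, hα, hβ, h⟩ := hD
  obtain ⟨C, C', hP⟩ := ChoreDivision.allocate_withHighProbability h hα hβ
  refine ⟨fun m hm => ?_, _, ChoreDivision.runsInPolyTime_toProgram
    (ChoreDivision.allocate_wellFormed C C'), hP⟩
  refine tendsto_of_tendsto_of_tendsto_of_le_of_le tendsto_const_nhds (hP m hm)
    (fun n => zero_le) fun n => measure_mono ?_
  intro d hd hfind
  obtain ⟨s, -, -, hA, hE⟩ := hfind
  exact hd ⟨_, hA, hE⟩
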